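/- **Setting.** Let $\mathbb Z'=\mathbb Z+\tfrac12$, and let $E_{ij}$ ($i,j\in\mathbb Z'$) act on (completed) fermionic Fock space as the normally ordered operators ${:}\psi_i\psi_j^*{:}$, with vacuum $|0\rangle$, covacuum $\langle 0|$ and $\langle A\rangle=\langle 0|A|0\rangle$. Put $J_n=\sum_{l\in\mathbb Z'}E_{l-n,l}$ for $n\neq 0$. For $k\ge 0$ let $w_k(j,\hbar)=\sum_{r\ge0}w_{k,r}(\hbar)\,j^r$ be formal series with $w_{k,r}\in\mathbb C((\hbar))$ such that $w_k(\tfrac s\hbar,\hbar)\in\hbar^{-1}\mathbb C[[s,\hbar^2]]$ for all $k$. Define the cut-and-join operator and its dequantised generating function by $$W=\sum_{l\in\mathbb Z'}\sum_{k\ge0}w_k\bigl(l+\tfrac k2,\hbar\bigr)E_{l+k,l},\qquad \mathfrak w(z,s)=[\hbar^{-1}]\sum_{k\ge0}w_k\bigl(\tfrac s\hbar,\hbar\bigr)z^k\in\mathbb C[[z,s]].$$ Let $s_1,s_2,\dots\in\mathbb C$ and $S(z)=\sum_{q\ge1}s_qz^q$. Put $$H_{0,1}(X)=\sum_{m\ge1}\frac{X^m}{m}\,[\hbar^{-1}]\Bigl\langle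 J_m\,e^W e^{\sum_{q\ge1}s_qJ_{-q}/(q\hbar)}\Bigr\rangle,\qquad \omega_{0,1}=dH_{0,1}.$$ Let $V_{\mathfrak w}=(z\partial_z\mathfrak w)\,\partial_s-(\partial_s\mathfrak w)\,z\partial_z$ be the Hamiltonian vector field of $\mathfrak w$ for the symplectic form $\Omega=\frac{dz}{z}\wedge ds$ (with the convention $\Omega(V_{\mathfrak w},\cdot)=-d\mathfrak w$), and let $\Xi_\beta=e^{\beta V_{\mathfrak w}}z$, $\Upsilon_\beta=e^{\beta V_{\mathfrak w}}s$, where $e^{\beta V_{\mathfrak w}}f=\sum_{n\ge0}\frac{\beta^n}{n!}V_{\mathfrak w}^nf$ is summed coefficientwise in $z,s$. **Proposition.** Assume that $\mathfrak w\in s\,\mathbb C[[z,s]]$. Then: 1. the series $e^{V_{\mathfrak w}}f$ converges coefficientwise for every $f\in\mathbb C[[z,s]]$, so that $\Xi_1,\Upsilon_1\in\mathbb C[[z,s]]$ are well defined; and the exponentials in $e^We^{\sum_q s_qJ_{-q}/(q\hbar)}|0\rangle$ converge coefficientwise, so that $H_{0,1}\in\mathbb C[[X]]$ is well defined; 2.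 with $$X(z)=\Xi_1(z,S(z)),\qquad y(z)=\Upsilon_1(z,S(z))-\Upsilon_1(z,0),$$ one has $X(0)=0$ and $X'(0)\ne0$, so that $X(z)$ is a formal coordinate at $z=0$, and $$\omega_{0,1}(X(z))=y(z)\,\frac{dX(z)}{X(z)}$$ as formal differentials in $z$. -/

import Mathlib

open scoped Nat PowerSeries

noncomputable section

namespace LeakyHurwitz

/-! ## Fermionic Fock space

The half-integer `n + 1/2` is encoded by the integer `n`; it is positive iff `0 ≤ n`. -/

/-- Maya diagrams: sets of half-integers that contain finitely many positive and omit finitely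
many negative ones. The diagram with elements `s₁ > s₂ > ⋯` labels `v_{s₁} ∧ v_{s₂} ∧ ⋯`. -/
@[ext]
structure Maya where
  carrier : Set ℤ
  finite_pos : {n | n ∈ carrier ∧ 0 ≤ n}.Finite
  finite_neg : {n | n ∉ carrier ∧ n < 0}.Finite

namespace Maya

/-- The vacuum diagram: all negative half-integers. -/
def vac : Maya where
  carrier := {n | n < 0}
  finite_pos := by
    convert Set.finite_empty (α := ℤ) using 1
    ext n; simp
  finite_neg := by
    convert Set.finite_empty (α := ℤ) using 1
    ext n; simp

/-- Add the particle `i`. -/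
def insert (T : Maya) (i : ℤ) : Maya where
  carrier := Insert.insert i T.carrier
  finite_pos := (T.finite_pos.union (Set.finite_singleton i)).subset (by
    rintro n ⟨rfl | h, h'⟩
    · exact Or.inr rfl
    · exact Or.inl ⟨h, h'⟩)
  finite_neg := T.finite_neg.subset (by
    rintro n ⟨h, h'⟩
    exact ⟨fun hn => h (Or.inr hn), h'⟩)

/-- Remove the particle `i`. -/
def erase (T : Maya) (i : ℤ) : Maya where
  carrier := T.carrier \ {i}
  finite_pos := T.finite_pos.subset (by
    rintro n ⟨h, h'⟩
    exact ⟨h.1, h'⟩)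
  finite_neg := (T.finite_neg.union (Set.finite_singleton i)).subset (by
    rintro n ⟨h, h'⟩
    by_cases hn : n = i
    · exact Or.inr hn
    · exact Or.inl ⟨fun hT => h ⟨hT, hn⟩, h'⟩)

/-- The sign of moving `v_i` past the vectors `v_s`, `s > i`, of the wedge product. -/
def sign (T : Maya) (i : ℤ) : ℤ := (-1) ^ {n | n ∈ T.carrier ∧ i < n}.ncard

end Maya

/-- The completed fermionic Fock space over `ℂ((ħ))`: `f` stands for the (possibly infinite)
combination `∑_T f(T) |T⟩`. All charges are included; every operator `E i j` below preserves
the charge, so that the vacuum lives in, and only sees, the charge-zero part. -/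
abbrev Fock : Type := Maya → LaurentSeries ℂ

/-- The vacuum `|0⟩`. -/
def vacuum : Fock := by
  classical exact Pi.single Maya.vac 1

/-- The covacuum `⟨0| f`. -/
def covacuum (f : Fock) : LaurentSeries ℂ := f Maya.vac

open Classical in
/-- `ψ_i = v_i ∧ ·`, on coefficient functions. -/
def psi (i : ℤ) (f : Fock) : Fock := fun T =>
  if i ∈ T.carrier then T.sign i • f (T.erase i) else 0

open Classical in
/-- `ψ_i^*`, the contraction with `v_i`, on coefficient functions. -/
def psiStar (i : ℤ) (f : Fock) : Fock := fun T =>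
  if i ∈ T.carrier then 0 else T.sign i • f (T.insert i)

/-- The action of the generator `E_{ij}` of `â_∞`, i.e. the normally ordered `ψ_i ψ_j^*`
(the central element `c` acts by the identity). -/
def E (i j : ℤ) (f : Fock) : Fock :=
  psi i (psiStar j f) - if i = j ∧ j < 0 then f else 0

/-- The operator `∑_{i,j} a_{ij} E_{ij}`. If `a_{ij} = 0` for `i ≪ j`, then the sum is finite at
each diagram `T`, because a nonzero term with `i ≠ j` needs `i ∈ T` and `j ∉ T`. -/
def ofMatrix (a : ℤ → ℤ → LaurentSeries ℂ) (f : Fock) : Fock := fun T =>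
  ∑ᶠ p : ℤ × ℤ, a p.1 p.2 * E p.1 p.2 f T

/-- The Heisenberg operators `J_n = ∑_l E_{l-n,l}` (used for `n ≠ 0`). -/
def J (n : ℤ) : Fock → Fock := ofMatrix fun i j => if i = j - n then 1 else 0

/-- `g = e^A f = ∑_N A^N f / N!`, as a convergent sum of complex numbers for each coefficient
(of a basis vector `|T⟩` and of a power of `ħ`). -/
def HasExp (A : Fock → Fock) (f g : Fock) : Prop :=
  ∀ (T : Maya) (n : ℤ), HasSum (fun N : ℕ => ((A^[N] f) T).coeff n / (N ! : ℂ)) ((g T).coeff n)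

open Classical in
/-- The vector `e^A f` (`0` if the exponential series does not converge). -/
def expApply (A : Fock → Fock) (f : Fock) : Fock :=
  if h : ∃ g, HasExp A f g then h.choose else 0

/-! ## Cut-and-join operators -/

/-- `ħ⁻¹` as a Laurent series. -/
def hbarInv : LaurentSeries ℂ := HahnSeries.single (-1) 1

/-- The standing assumption on the family `w_k(j, ħ) = ∑_r w_{k,r}(ħ) j^r`:
`w_k(s/ħ, ħ) ∈ ħ⁻¹ ℂ⟦s, ħ²⟧` for all `k`. -/
def TopologicalAssumption (w : ℕ → PowerSeries (LaurentSeries ℂ)) : Prop :=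
  ∀ (k r : ℕ) (n : ℤ), ((PowerSeries.rescale hbarInv (w k)).coeff r).coeff n ≠ 0 →
    ∃ g : ℕ, n = 2 * g - 1

theorem bddBelow_evalAt (w : PowerSeries (LaurentSeries ℂ)) (j : ℂ) :
    BddBelow (Function.support fun n : ℤ =>
      ∑ r ∈ Finset.range (n + 2).toNat, (w.coeff r).coeff n * j ^ r) := by
  refine ⟨-1, fun n hn => ?_⟩
  by_contra hlt
  apply hn
  have h0 : (n + 2).toNat = 0 := by omega
  simp [h0]

/-- The value `w(j, ħ)` at a number `j` of `w = ∑_r w_r(ħ) j^r`. Its coefficient of `ħ^n` is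
`∑_r [ħ^n] w_r(ħ) j^r`; the standing assumption makes the terms with `r > n + 1` vanish (see
`coeff_evalAt`), so only the others are written. -/
def evalAt (w : PowerSeries (LaurentSeries ℂ)) (j : ℂ) : LaurentSeries ℂ :=
  HahnSeries.ofSuppBddBelow
    (fun n : ℤ => ∑ r ∈ Finset.range (n + 2).toNat, (w.coeff r).coeff n * j ^ r)
    (bddBelow_evalAt w j)

theorem coeff_evalAt (w : ℕ → PowerSeries (LaurentSeries ℂ)) (hw : TopologicalAssumption w)
    (k : ℕ) (j : ℂ) (n : ℤ) :
    (evalAt (w k) j).coeff n = ∑ᶠ r : ℕ, ((w k).coeff r).coeff n * j ^ r := by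
  have key : ∀ r : ℕ, n + 2 ≤ r → ((w k).coeff r).coeff n = 0 := by
    intro r hr
    by_contra hne
    have h1 := hw k r (n - r)
    have h2 : ((PowerSeries.rescale hbarInv (w k)).coeff r).coeff (n - r)
        = ((w k).coeff r).coeff n := by
      rw [PowerSeries.coeff_rescale, hbarInv, HahnSeries.single_pow]
      have h3 := HahnSeries.coeff_single_mul_add (r := (1 : ℂ) ^ r) (x := (w k).coeff r)
        (a := n) (b := r • (-1 : ℤ))
      have h4 : n + r • (-1 : ℤ) = n - r := by simp [sub_eq_add_neg]
      rw [h4] at h3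
      rw [h3]; simp
    obtain ⟨g, hg⟩ := h1 (by rw [h2]; exact hne)
    omega
  rw [finsum_eq_sum_of_support_subset (s := Finset.range (n + 2).toNat)]
  · rfl
  · intro r hr
    by_contra hlt
    apply hr
    have h5 : n + 2 ≤ r := by
      simp only [Finset.coe_range, Set.mem_Iio, not_lt] at hlt
      omega
    simp [key r h5]

/-- The cut-and-join operator `W = ∑_{l ∈ ℤ + 1/2} ∑_{k ≥ 0} w_k(l + k/2, ħ) E_{l+k,l}`. Here the
half-integer `l` is `j + 1/2` and `k = i - j`. -/
def W (w : ℕ → PowerSeries (LaurentSeries ℂ)) : Fock → Fock :=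
  ofMatrix fun i j =>
    if j ≤ i then evalAt (w (i - j).toNat) (((j : ℂ) + 1 / 2) + ((i : ℂ) - (j : ℂ)) / 2) else 0

/-- The secondary ramification operator `∑_{q ≥ 1} s_q J_{-q} / (q ħ)`. -/
def ramification (s : ℕ+ → ℂ) (f : Fock) : Fock := fun T =>
  ∑ᶠ q : ℕ+, HahnSeries.single (-1) (s q / (q : ℂ)) * J (-(q : ℤ)) f T

/-- The vector `e^{∑_q s_q J_{-q} / (q ħ)} |0⟩`. -/
def ramificationVector (s : ℕ+ → ℂ) : Fock := expApply (ramification s) vacuum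

/-- `⟨ J_m e^W e^{∑_q s_q J_{-q} / (q ħ)} ⟩`. -/
def onePoint (w : ℕ → PowerSeries (LaurentSeries ℂ)) (s : ℕ+ → ℂ) (m : ℕ) : LaurentSeries ℂ :=
  covacuum (J m (expApply (W w) (ramificationVector s)))

/-- `H_{0,1}(X)`, the coefficient of `ħ⁻¹` in the one-point function
`H_1(X) = ∑_{m ≥ 1} (X^m / m) ⟨ J_m e^W e^{∑_q s_q J_{-q} / (q ħ)} ⟩`
(for one point, connected and disconnected functions agree). -/
def H01 (w : ℕ → PowerSeries (LaurentSeries ℂ)) (s : ℕ+ → ℂ) : ℂ⟦X⟧ :=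
  PowerSeries.mk fun m => if m = 0 then 0 else (onePoint w s m).coeff (-1) / (m : ℂ)

/-- The coefficient of `dX` in `ω_{0,1} = d H_{0,1}`. -/
def omega01 (w : ℕ → PowerSeries (LaurentSeries ℂ)) (s : ℕ+ → ℂ) : ℂ⟦X⟧ :=
  PowerSeries.derivative ℂ (H01 w s)

/-! ## The Hamiltonian flow

In `MvPowerSeries (Fin 2) ℂ = ℂ⟦z, s⟧` the variable `0` is `z` and the variable `1` is `s`. -/

/-- The dequantisation `𝔴(z,s) = [ħ⁻¹] ∑_k w_k(s/ħ, ħ) z^k`. -/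
def dequantisation (w : ℕ → PowerSeries (LaurentSeries ℂ)) : MvPowerSeries (Fin 2) ℂ :=
  fun e => ((PowerSeries.rescale hbarInv (w (e 0))).coeff (e 1)).coeff (-1)

/-- `z ∂_z`. -/
def zdz (f : MvPowerSeries (Fin 2) ℂ) : MvPowerSeries (Fin 2) ℂ :=
  MvPowerSeries.X 0 * MvPowerSeries.pderiv ℂ 0 f

/-- `∂_s`. -/
def ds (f : MvPowerSeries (Fin 2) ℂ) : MvPowerSeries (Fin 2) ℂ := MvPowerSeries.pderiv ℂ 1 f

/-- The Hamiltonian vector field `V_h = (z ∂_z h) ∂_s - (∂_s h) z ∂_z` of `h` for the symplectic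
form `Ω = dz/z ∧ ds`, i.e. `Ω(V_h, ·) = -dh`, as a derivation. -/
def hamiltonianField (h f : MvPowerSeries (Fin 2) ℂ) : MvPowerSeries (Fin 2) ℂ :=
  zdz h * ds f - ds h * zdz f

/-- `e^{β V_h} f = ∑_n β^n V_h^n f / n!`, coefficient by coefficient. -/
def flow (h : MvPowerSeries (Fin 2) ℂ) (β : ℂ) (f : MvPowerSeries (Fin 2) ℂ) :
    MvPowerSeries (Fin 2) ℂ :=
  fun e => ∑' n : ℕ, β ^ n / (n ! : ℂ) * MvPowerSeries.coeff e ((hamiltonianField h)^[n] f)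

/-- `Ξ_β = e^{β V_h} z`. -/
def Xi (h : MvPowerSeries (Fin 2) ℂ) (β : ℂ) : MvPowerSeries (Fin 2) ℂ :=
  flow h β (MvPowerSeries.X 0)

/-- `Υ_β = e^{β V_h} s`. -/
def Upsilon (h : MvPowerSeries (Fin 2) ℂ) (β : ℂ) : MvPowerSeries (Fin 2) ℂ :=
  flow h β (MvPowerSeries.X 1)

/-- `S(z) = ∑_{q ≥ 1} s_q z^q`. -/
def ramificationSeries (s : ℕ+ → ℂ) : ℂ⟦X⟧ :=
  PowerSeries.mk fun q => if hq : 0 < q then s ⟨q, hq⟩ else 0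

/-- `f(z, A(z))`, for a power series `A` without constant term. -/
def evalCurve (f : MvPowerSeries (Fin 2) ℂ) (A : ℂ⟦X⟧) : ℂ⟦X⟧ :=
  MvPowerSeries.subst ![(PowerSeries.X : ℂ⟦X⟧), A] f

/-- `X(z) = Ξ_1(z, S(z))`. -/
def curveX (w : ℕ → PowerSeries (LaurentSeries ℂ)) (s : ℕ+ → ℂ) : ℂ⟦X⟧ :=
  evalCurve (Xi (dequantisation w) 1) (ramificationSeries s)

/-- `y(z) = Υ_1(z, S(z)) - Υ_1(z, 0)`. -/
def curveY (w : ℕ → PowerSeries (LaurentSeries ℂ)) (s : ℕ+ → ℂ) : ℂ⟦X⟧ :=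
  evalCurve (Upsilon (dequantisation w) 1) (ramificationSeries s)
    - evalCurve (Upsilon (dequantisation w) 1) 0

end LeakyHurwitz

end

noncomputable section

open scoped Nat PowerSeries
open Finset.HasAntidiagonal (antidiagonal mem_antidiagonal)

namespace LeakyHurwitz

/-! ## Bivariate power series -/

/-- The exponent of the monomial `z^n s^k`. -/
def bidegree (n k : ℕ) : Fin 2 →₀ ℕ := Finsupp.single 0 n + Finsupp.single 1 k

@[simp] theorem bidegree_zero (n k : ℕ) : bidegree n k 0 = n := by simp [bidegree]

@[simp] theorem bidegree_one (n k : ℕ) : bidegree n k 1 = k := by simp [bidegree]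

theorem bidegree_eta (e : Fin 2 →₀ ℕ) : bidegree (e 0) (e 1) = e := by
  ext i; fin_cases i <;> simp

/-- The coefficient of `z^n s^k`. -/
def cf (f : MvPowerSeries (Fin 2) ℂ) (n k : ℕ) : ℂ := MvPowerSeries.coeff (bidegree n k) f

theorem coeff_eq_cf (f : MvPowerSeries (Fin 2) ℂ) (e : Fin 2 →₀ ℕ) :
    MvPowerSeries.coeff e f = cf f (e 0) (e 1) := by
  rw [cf, bidegree_eta]

theorem cf_ext {f g : MvPowerSeries (Fin 2) ℂ} (h : ∀ n k, cf f n k = cf g n k) : f = g := by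
  ext e
  rw [coeff_eq_cf, coeff_eq_cf, h]

@[simp] theorem cf_add (f g : MvPowerSeries (Fin 2) ℂ) (n k : ℕ) :
    cf (f + g) n k = cf f n k + cf g n k := map_add _ _ _

@[simp] theorem cf_sub (f g : MvPowerSeries (Fin 2) ℂ) (n k : ℕ) :
    cf (f - g) n k = cf f n k - cf g n k := map_sub _ _ _

@[simp] theorem cf_smul (c : ℂ) (f : MvPowerSeries (Fin 2) ℂ) (n k : ℕ) :
    cf (c • f) n k = c * cf f n k := by simp [cf]

theorem cf_sum {ι : Type*} (s : Finset ι) (f : ι → MvPowerSeries (Fin 2) ℂ) (n k : ℕ) :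
    cf (∑ i ∈ s, f i) n k = ∑ i ∈ s, cf (f i) n k := map_sum _ _ _

theorem cf_one (n k : ℕ) : cf 1 n k = if n = 0 ∧ k = 0 then 1 else 0 := by
  classical
  rw [cf, MvPowerSeries.coeff_one]
  refine if_congr ?_ rfl rfl
  rw [DFunLike.ext_iff, Fin.forall_fin_two]
  simp

theorem cf_X_zero (n k : ℕ) :
    cf (MvPowerSeries.X 0) n k = if n = 1 ∧ k = 0 then 1 else 0 := by
  classical
  rw [cf, MvPowerSeries.coeff_X]
  refine if_congr ?_ rfl rfl
  rw [DFunLike.ext_iff, Fin.forall_fin_two]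
  simp

theorem cf_X_one (n k : ℕ) :
    cf (MvPowerSeries.X 1) n k = if n = 0 ∧ k = 1 then 1 else 0 := by
  classical
  rw [cf, MvPowerSeries.coeff_X]
  refine if_congr ?_ rfl rfl
  rw [DFunLike.ext_iff, Fin.forall_fin_two]
  simp

theorem cf_mul (f g : MvPowerSeries (Fin 2) ℂ) (n k : ℕ) :
    cf (f * g) n k = ∑ p ∈ antidiagonal n, ∑ q ∈ antidiagonal k,
      cf f p.1 q.1 * cf g p.2 q.2 := by
  classical
  rw [cf, MvPowerSeries.coeff_mul, ← Finset.sum_product']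
  refine Finset.sum_bij' (fun e _ => ((e.1 0, e.2 0), (e.1 1, e.2 1)))
    (fun x _ => (bidegree x.1.1 x.2.1, bidegree x.1.2 x.2.2)) ?_ ?_ ?_ ?_ ?_
  · rintro ⟨a, b⟩ h
    rw [mem_antidiagonal] at h
    simp [← Finsupp.add_apply, h]
  · rintro ⟨⟨a, b⟩, ⟨c, d⟩⟩ h
    simp only [Finset.mem_product, mem_antidiagonal] at h
    rw [mem_antidiagonal]
    ext i
    fin_cases i <;> simp [h]
  · rintro ⟨a, b⟩ _
    simp [bidegree_eta]
  · rintro ⟨⟨a, b⟩, ⟨c, d⟩⟩ _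
    simp
  · rintro ⟨a, b⟩ _
    simp [coeff_eq_cf]

@[simp] theorem cf_ds (f : MvPowerSeries (Fin 2) ℂ) (n k : ℕ) :
    cf (ds f) n k = (k + 1) * cf f n (k + 1) := by
  rw [cf, ds, MvPowerSeries.coeff_pderiv, coeff_eq_cf]
  simp [mul_comm]

@[simp] theorem cf_X_zero_mul_zero (f : MvPowerSeries (Fin 2) ℂ) (k : ℕ) :
    cf (MvPowerSeries.X 0 * f) 0 k = 0 := by
  simp [cf_mul, cf_X_zero]

@[simp] theorem cf_X_zero_mul_succ (f : MvPowerSeries (Fin 2) ℂ) (n k : ℕ) :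
    cf (MvPowerSeries.X 0 * f) (n + 1) k = cf f n k := by
  have : bidegree (n + 1) k = Finsupp.single 0 1 + bidegree n k := by
    ext i; fin_cases i <;> simp [add_comm]
  rw [cf, this, MvPowerSeries.X, MvPowerSeries.coeff_add_monomial_mul, one_mul, cf]

@[simp] theorem cf_zdz (f : MvPowerSeries (Fin 2) ℂ) (n k : ℕ) :
    cf (zdz f) n k = n * cf f n k := by
  cases n with
  | zero => simp [zdz]
  | succ n =>
    rw [zdz, cf_X_zero_mul_succ, cf, MvPowerSeries.coeff_pderiv, coeff_eq_cf]
    simp [mul_comm]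

theorem zdz_mul (f g : MvPowerSeries (Fin 2) ℂ) : zdz (f * g) = zdz f * g + f * zdz g := by
  simp only [zdz, Derivation.leibniz, smul_eq_mul]; ring

theorem ds_mul (f g : MvPowerSeries (Fin 2) ℂ) : ds (f * g) = ds f * g + f * ds g := by
  simp only [ds, Derivation.leibniz, smul_eq_mul]; ring

theorem ds_zdz (f : MvPowerSeries (Fin 2) ℂ) : ds (zdz f) = zdz (ds f) :=
  cf_ext fun n k => by simp; ring

@[simp] theorem zdz_add (f g : MvPowerSeries (Fin 2) ℂ) : zdz (f + g) = zdz f + zdz g := by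
  simp [zdz, mul_add]

@[simp] theorem ds_add (f g : MvPowerSeries (Fin 2) ℂ) : ds (f + g) = ds f + ds g := by
  simp [ds]

@[simp] theorem zdz_sub (f g : MvPowerSeries (Fin 2) ℂ) : zdz (f - g) = zdz f - zdz g := by
  simp [zdz, mul_sub]

@[simp] theorem ds_sub (f g : MvPowerSeries (Fin 2) ℂ) : ds (f - g) = ds f - ds g := by
  simp [ds]

@[simp] theorem zdz_smul (c : ℂ) (f : MvPowerSeries (Fin 2) ℂ) : zdz (c • f) = c • zdz f := by
  simp [zdz]

@[simp] theorem ds_smul (c : ℂ) (f : MvPowerSeries (Fin 2) ℂ) : ds (c • f) = c • ds f := by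
  simp [ds]

theorem zdz_one : zdz 1 = 0 := by simp [zdz]

theorem ds_one : ds 1 = 0 := by simp [ds]

theorem zdz_X_zero : zdz (MvPowerSeries.X 0) = MvPowerSeries.X 0 := by
  refine cf_ext fun n k => ?_
  rw [cf_zdz, cf_X_zero]
  split_ifs with h <;> simp [h]

theorem ds_X_zero : ds (MvPowerSeries.X 0) = 0 := by
  refine cf_ext fun n k => ?_
  rw [cf_ds, cf_X_zero]
  simp [cf]

theorem ds_X_one : ds (MvPowerSeries.X 1) = 1 := by
  refine cf_ext fun n k => ?_
  rw [cf_ds, cf_X_one, cf_one]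
  split_ifs with h h' h' <;> simp_all

/-! ## Twisted Hamiltonian fields -/

/-- The operator `f ↦ z^c V_h (z^{-c} f)`. -/
def twistedField (h : MvPowerSeries (Fin 2) ℂ) (c : ℂ) :
    MvPowerSeries (Fin 2) ℂ →ₗ[ℂ] MvPowerSeries (Fin 2) ℂ where
  toFun f := hamiltonianField h f + c • (ds h * f)
  map_add' f g := by simp only [hamiltonianField, ds_add, zdz_add, mul_add, smul_add]; ring
  map_smul' a f := by
    simp only [hamiltonianField, ds_smul, zdz_smul, RingHom.id_apply, mul_smul_comm, smul_add,
      smul_sub, smul_comm a c]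

theorem twistedField_apply (h : MvPowerSeries (Fin 2) ℂ) (c : ℂ) (f : MvPowerSeries (Fin 2) ℂ) :
    twistedField h c f = hamiltonianField h f + c • (ds h * f) := rfl

theorem twistedField_zero_apply (h f : MvPowerSeries (Fin 2) ℂ) :
    twistedField h 0 f = hamiltonianField h f := by simp [twistedField_apply]

theorem twistedField_mul (h : MvPowerSeries (Fin 2) ℂ) (a b : ℂ)
    (f g : MvPowerSeries (Fin 2) ℂ) :
    twistedField h (a + b) (f * g) = twistedField h a f * g + f * twistedField h b g := by
  simp only [twistedField_apply, hamiltonianField, zdz_mul, ds_mul, add_smul, mul_add, add_mul,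
    smul_mul_assoc, mul_smul_comm]
  simp only [MvPowerSeries.smul_eq_C_mul]
  ring

theorem cf_twistedField (h : MvPowerSeries (Fin 2) ℂ) (c : ℂ) (f : MvPowerSeries (Fin 2) ℂ)
    (n k : ℕ) :
    cf (twistedField h c f) n k = ∑ p ∈ antidiagonal n, ∑ q ∈ antidiagonal (k + 1),
      ((p.2 : ℂ) * q.1 - (p.1 - c) * q.2) * (cf f p.1 q.1 * cf h p.2 q.2) := by
  rw [twistedField_apply, hamiltonianField, mul_comm (zdz h), mul_comm (ds h), mul_comm (ds h)]
  simp only [cf_add, cf_sub, cf_smul, cf_mul, cf_ds, cf_zdz]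
  rw [Finset.mul_sum, ← Finset.sum_sub_distrib, ← Finset.sum_add_distrib]
  refine Finset.sum_congr rfl fun p _ => ?_
  have h1 : ∑ q ∈ antidiagonal k,
        ((q.1 : ℂ) + 1) * cf f p.1 (q.1 + 1) * (p.2 * cf h p.2 q.2)
      = ∑ q ∈ antidiagonal (k + 1), (p.2 : ℂ) * q.1 * (cf f p.1 q.1 * cf h p.2 q.2) := by
    rw [Finset.Nat.antidiagonal_succ, Finset.sum_cons, Finset.sum_map]
    simp only [Nat.cast_zero, mul_zero, zero_mul, zero_add]
    refine Finset.sum_congr rfl fun q _ => ?_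
    simp; ring
  have h2 : ∀ a : ℂ, ∑ q ∈ antidiagonal k,
        a * (cf f p.1 q.1 * ((q.2 + 1) * cf h p.2 (q.2 + 1)))
      = ∑ q ∈ antidiagonal (k + 1), a * q.2 * (cf f p.1 q.1 * cf h p.2 q.2) := by
    intro a
    rw [Finset.Nat.antidiagonal_succ', Finset.sum_cons, Finset.sum_map]
    simp only [Nat.cast_zero, mul_zero, zero_mul, zero_add]
    refine Finset.sum_congr rfl fun q _ => ?_
    simp; ring
  have h3 := h2 p.1
  have h4 := h2 c
  rw [h1, Finset.mul_sum, h4]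
  simp only [mul_assoc] at h3 ⊢
  rw [h3, ← Finset.sum_sub_distrib, ← Finset.sum_add_distrib]
  exact Finset.sum_congr rfl fun q _ => by ring

/-! ## Exponentials of vector fields -/

/-- Exponential series of sequences that satisfy a finite linear recurrence converge. -/
theorem summable_of_linear_recurrence {ι : Type*} (F : Finset ι) (u : ℕ → ι → ℂ) (M : ι → ι → ℂ)
    (h : ∀ n, ∀ e ∈ F, u (n + 1) e = ∑ e' ∈ F, M e e' * u n e') {e : ι} (he : e ∈ F) :
    Summable fun n : ℕ => u n e / (n ! : ℂ) := by
  set K : ℝ := ∑ e ∈ F, ∑ e' ∈ F, ‖M e e'‖ with hK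
  set B : ℝ := ∑ e ∈ F, ‖u 0 e‖ with hB
  have hK0 : 0 ≤ K := by positivity
  have hB0 : 0 ≤ B := by positivity
  have bound : ∀ n, ∀ e ∈ F, ‖u n e‖ ≤ K ^ n * B := by
    intro n
    induction n with
    | zero =>
      intro e he
      rw [pow_zero, one_mul]
      exact Finset.single_le_sum (f := fun e => ‖u 0 e‖) (fun _ _ => norm_nonneg _) he
    | succ n ih =>
      intro e he
      rw [h n e he]
      calc ‖∑ e' ∈ F, M e e' * u n e'‖ ≤ ∑ e' ∈ F, ‖M e e'‖ * (K ^ n * B) := by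
            refine (norm_sum_le _ _).trans (Finset.sum_le_sum fun e' he' => ?_)
            rw [norm_mul]
            exact mul_le_mul_of_nonneg_left (ih e' he') (norm_nonneg _)
        _ = (∑ e' ∈ F, ‖M e e'‖) * (K ^ n * B) := by rw [Finset.sum_mul]
        _ ≤ K * (K ^ n * B) := by
            refine mul_le_mul_of_nonneg_right ?_ (by positivity)
            exact Finset.single_le_sum (f := fun e => ∑ e' ∈ F, ‖M e e'‖)
              (fun _ _ => by positivity) he
        _ = K ^ (n + 1) * B := by ring
  refine Summable.of_norm_bounded ((Real.summable_pow_div_factorial K).mul_right B) fun n => ?_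
  rw [norm_div, Complex.norm_natCast, div_mul_eq_mul_div]
  exact div_le_div_of_nonneg_right (bound n e he) (by positivity)

/-- Coefficientwise convergence of a series of bivariate power series. -/
def CoeffSum (u : ℕ → MvPowerSeries (Fin 2) ℂ) (g : MvPowerSeries (Fin 2) ℂ) : Prop :=
  ∀ n k, HasSum (fun N => cf (u N) n k) (cf g n k)

theorem CoeffSum.unique {u : ℕ → MvPowerSeries (Fin 2) ℂ} {f g : MvPowerSeries (Fin 2) ℂ}
    (hf : CoeffSum u f) (hg : CoeffSum u g) : f = g :=
  cf_ext fun n k => (hf n k).unique (hg n k)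

theorem CoeffSum.sub {u v : ℕ → MvPowerSeries (Fin 2) ℂ} {f g : MvPowerSeries (Fin 2) ℂ}
    (hf : CoeffSum u f) (hg : CoeffSum v g) : CoeffSum (fun N => u N - v N) (f - g) := by
  intro n k
  simpa using (hf n k).sub (hg n k)

theorem CoeffSum.zdz {u : ℕ → MvPowerSeries (Fin 2) ℂ} {f : MvPowerSeries (Fin 2) ℂ}
    (hf : CoeffSum u f) : CoeffSum (fun N => zdz (u N)) (zdz f) := by
  intro n k
  simpa using (hf n k).mul_left (n : ℂ)

theorem CoeffSum.ds {u : ℕ → MvPowerSeries (Fin 2) ℂ} {f : MvPowerSeries (Fin 2) ℂ}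
    (hf : CoeffSum u f) : CoeffSum (fun N => ds (u N)) (ds f) := by
  intro n k
  simpa using (hf n (k + 1)).mul_left ((k : ℂ) + 1)

theorem CoeffSum.mul {u v : ℕ → MvPowerSeries (Fin 2) ℂ} {f g : MvPowerSeries (Fin 2) ℂ}
    (hf : CoeffSum u f) (hg : CoeffSum v g) :
    CoeffSum (fun N => ∑ x ∈ antidiagonal N, u x.1 * v x.2) (f * g) := by
  intro n k
  have key : ∀ a b c d : ℕ, HasSum
      (fun N => ∑ x ∈ antidiagonal N, cf (u x.1) a b * cf (v x.2) c d) (cf f a b * cf g c d) := by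
    intro a b c d
    have h1 := (hf a b).summable.norm
    have h2 := (hg c d).summable.norm
    rw [← (hf a b).tsum_eq, ← (hg c d).tsum_eq,
      tsum_mul_tsum_eq_tsum_sum_antidiagonal_of_summable_norm h1 h2]
    exact (summable_norm_sum_mul_antidiagonal_of_summable_norm h1 h2).of_norm.hasSum
  have := hasSum_sum (s := antidiagonal n ×ˢ antidiagonal k)
    fun x _ => key x.1.1 x.2.1 x.1.2 x.2.2
  rw [cf_mul, ← Finset.sum_product']
  convert this using 2 with N
  simp only [cf_sum, cf_mul]
  rw [Finset.sum_product, Finset.sum_comm]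
  exact Finset.sum_congr rfl fun p _ => Finset.sum_comm

/-- The terms of the exponential series of a linear operator. -/
def expTerm (L : MvPowerSeries (Fin 2) ℂ →ₗ[ℂ] MvPowerSeries (Fin 2) ℂ)
    (f : MvPowerSeries (Fin 2) ℂ) (N : ℕ) : MvPowerSeries (Fin 2) ℂ :=
  (N ! : ℂ)⁻¹ • L^[N] f

theorem expTerm_succ (L : MvPowerSeries (Fin 2) ℂ →ₗ[ℂ] MvPowerSeries (Fin 2) ℂ)
    (f : MvPowerSeries (Fin 2) ℂ) (N : ℕ) :
    L (expTerm L f N) = ((N : ℂ) + 1) • expTerm L f (N + 1) := by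
  have h : (N : ℂ) + 1 ≠ 0 := by exact_mod_cast N.succ_ne_zero
  rw [expTerm, expTerm, map_smul, Function.iterate_succ_apply', smul_smul, Nat.factorial_succ]
  push_cast
  rw [mul_inv, mul_inv_cancel_left₀ h]

/-- `e^L f`, coefficient by coefficient. -/
def expSum (L : MvPowerSeries (Fin 2) ℂ →ₗ[ℂ] MvPowerSeries (Fin 2) ℂ)
    (f : MvPowerSeries (Fin 2) ℂ) : MvPowerSeries (Fin 2) ℂ :=
  fun e => ∑' N, cf (expTerm L f N) (e 0) (e 1)

theorem expTerm_bilinear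
    {L₁ L₂ L₃ : MvPowerSeries (Fin 2) ℂ →ₗ[ℂ] MvPowerSeries (Fin 2) ℂ}
    (B : MvPowerSeries (Fin 2) ℂ →ₗ[ℂ] MvPowerSeries (Fin 2) ℂ →ₗ[ℂ] MvPowerSeries (Fin 2) ℂ)
    (hB : ∀ f g, L₃ (B f g) = B (L₁ f) g + B f (L₂ g)) (f g : MvPowerSeries (Fin 2) ℂ) (N : ℕ) :
    expTerm L₃ (B f g) N = ∑ x ∈ antidiagonal N, B (expTerm L₁ f x.1) (expTerm L₂ g x.2) := by
  induction N with
  | zero => simp [expTerm]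
  | succ N ih =>
    have h : (N : ℂ) + 1 ≠ 0 := by exact_mod_cast N.succ_ne_zero
    apply smul_right_injective _ h
    simp only
    rw [← expTerm_succ, ih, map_sum, Finset.smul_sum]
    have h1 : ∀ x ∈ antidiagonal (N + 1),
        ((N : ℂ) + 1) • B (expTerm L₁ f x.1) (expTerm L₂ g x.2)
          = B ((x.1 : ℂ) • expTerm L₁ f x.1) (expTerm L₂ g x.2)
            + B (expTerm L₁ f x.1) ((x.2 : ℂ) • expTerm L₂ g x.2) := by
      intro x hx
      rw [mem_antidiagonal] at hx
      have : (N : ℂ) + 1 = x.1 + x.2 := by exact_mod_cast hx.symm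
      rw [this, map_smul, map_smul, LinearMap.smul_apply, add_smul]
    rw [Finset.sum_congr rfl h1, Finset.sum_add_distrib]
    simp only [hB, Finset.sum_add_distrib]
    congr 1
    · rw [Finset.Nat.antidiagonal_succ, Finset.sum_cons, Finset.sum_map]
      simp [expTerm_succ]
    · rw [Finset.Nat.antidiagonal_succ', Finset.sum_cons, Finset.sum_map]
      simp [expTerm_succ]

theorem cf_twistedField_of_dvd {h : MvPowerSeries (Fin 2) ℂ} (hh : ∀ n, cf h n 0 = 0) (c : ℂ)
    (f : MvPowerSeries (Fin 2) ℂ) (n k : ℕ) :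
    cf (twistedField h c f) n k = ∑ x ∈ Finset.range (n + 1) ×ˢ Finset.range (k + 1),
      (((n - x.1 : ℕ) : ℂ) * x.2 - (x.1 - c) * (k + 1 - x.2 : ℕ)) * cf h (n - x.1) (k + 1 - x.2)
        * cf f x.1 x.2 := by
  rw [cf_twistedField, Finset.sum_product, Finset.Nat.sum_antidiagonal_eq_sum_range_succ_mk]
  refine Finset.sum_congr rfl fun p _ => ?_
  rw [Finset.Nat.sum_antidiagonal_eq_sum_range_succ_mk, Finset.sum_range_succ]
  simp only [Nat.sub_self, hh, mul_zero, add_zero]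
  exact Finset.sum_congr rfl fun q _ => by ring

theorem summable_twistedField {h : MvPowerSeries (Fin 2) ℂ} (hh : ∀ n, cf h n 0 = 0) (c : ℂ)
    (f : MvPowerSeries (Fin 2) ℂ) (n k : ℕ) :
    Summable fun N : ℕ => cf ((twistedField h c)^[N] f) n k / (N ! : ℂ) := by
  refine summable_of_linear_recurrence (Finset.range (n + 1) ×ˢ Finset.range (k + 1))
    (fun N e => cf ((twistedField h c)^[N] f) e.1 e.2)
    (fun e x => if x.1 ≤ e.1 ∧ x.2 ≤ e.2 then
      (((e.1 - x.1 : ℕ) : ℂ) * x.2 - (x.1 - c) * (e.2 + 1 - x.2 : ℕ))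
        * cf h (e.1 - x.1) (e.2 + 1 - x.2) else 0) ?_ (e := (n, k)) (by simp)
  rintro N ⟨a, b⟩ he
  simp only [Finset.mem_product, Finset.mem_range] at he
  simp only [Function.iterate_succ_apply']
  rw [cf_twistedField_of_dvd hh]
  refine Finset.sum_subset_zero_on_sdiff ?_ ?_ ?_
  · rintro ⟨p, q⟩ hpq
    simp only [Finset.mem_product, Finset.mem_range] at hpq ⊢
    omega
  · rintro ⟨p, q⟩ hpq
    simp only [Finset.mem_sdiff, Finset.mem_product, Finset.mem_range] at hpq
    rw [if_neg (by simp only; omega), zero_mul]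
  · rintro ⟨p, q⟩ hpq
    simp only [Finset.mem_product, Finset.mem_range] at hpq
    rw [if_pos (by simp only; omega)]

theorem coeffSum_expSum {h : MvPowerSeries (Fin 2) ℂ} (hh : ∀ n, cf h n 0 = 0) (c : ℂ)
    (f : MvPowerSeries (Fin 2) ℂ) :
    CoeffSum (expTerm (twistedField h c) f) (expSum (twistedField h c) f) := by
  intro n k
  have h1 : cf (expSum (twistedField h c) f) n k
      = ∑' N, cf (expTerm (twistedField h c) f N) n k := by
    change ∑' N, cf (expTerm (twistedField h c) f N) (bidegree n k 0) (bidegree n k 1) = _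
    simp
  rw [h1]
  refine Summable.hasSum ?_
  simpa [expTerm, div_eq_inv_mul] using summable_twistedField hh c f n k

theorem expSum_mul {h : MvPowerSeries (Fin 2) ℂ} (hh : ∀ n, cf h n 0 = 0) (a b : ℂ)
    (f g : MvPowerSeries (Fin 2) ℂ) :
    expSum (twistedField h (a + b)) (f * g)
      = expSum (twistedField h a) f * expSum (twistedField h b) g := by
  refine (coeffSum_expSum hh (a + b) (f * g)).unique ?_
  have := (coeffSum_expSum hh a f).mul (coeffSum_expSum hh b g)
  convert this using 2 with N
  exact expTerm_bilinear (LinearMap.mul ℂ _) (fun f g => twistedField_mul h a b f g) f g N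

/-- The Poisson bracket of `dz/z ∧ ds`. -/
def poisson : MvPowerSeries (Fin 2) ℂ →ₗ[ℂ] MvPowerSeries (Fin 2) ℂ →ₗ[ℂ]
    MvPowerSeries (Fin 2) ℂ :=
  LinearMap.mk₂ ℂ (fun f g => zdz f * ds g - ds f * zdz g)
    (fun f f' g => by simp only [zdz_add, ds_add]; ring)
    (fun c f g => by simp only [zdz_smul, ds_smul, smul_mul_assoc, smul_sub])
    (fun f g g' => by simp only [zdz_add, ds_add]; ring)
    (fun c f g => by simp only [zdz_smul, ds_smul, mul_smul_comm, smul_sub])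

theorem poisson_apply (f g : MvPowerSeries (Fin 2) ℂ) :
    poisson f g = zdz f * ds g - ds f * zdz g := rfl

theorem hamiltonianField_poisson (h f g : MvPowerSeries (Fin 2) ℂ) :
    hamiltonianField h (poisson f g)
      = poisson (hamiltonianField h f) g + poisson f (hamiltonianField h g) := by
  simp only [hamiltonianField, poisson_apply, zdz_sub, ds_sub, zdz_mul, ds_mul, ds_zdz]
  ring

theorem expSum_poisson {h : MvPowerSeries (Fin 2) ℂ} (hh : ∀ n, cf h n 0 = 0)
    (f g : MvPowerSeries (Fin 2) ℂ) :
    expSum (twistedField h 0) (poisson f g)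
      = poisson (expSum (twistedField h 0) f) (expSum (twistedField h 0) g) := by
  refine (coeffSum_expSum hh 0 (poisson f g)).unique ?_
  have hf := coeffSum_expSum hh 0 f
  have hg := coeffSum_expSum hh 0 g
  have := (hf.zdz.mul hg.ds).sub (hf.ds.mul hg.zdz)
  rw [poisson_apply (expSum _ f)]
  convert this using 2 with N
  rw [← Finset.sum_sub_distrib]
  exact expTerm_bilinear poisson (fun f g => by
    simp only [twistedField_zero_apply, hamiltonianField_poisson]) f g N

theorem flow_one (h f : MvPowerSeries (Fin 2) ℂ) : flow h 1 f = expSum (twistedField h 0) f := by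
  have h1 : ⇑(twistedField h 0) = hamiltonianField h := funext (twistedField_zero_apply h)
  funext e
  simp [flow, expSum, expTerm, h1, cf, bidegree_eta]

/-- The series `e^{V_h}(z^{-c}) z^c`. -/
def twistedFlow (h : MvPowerSeries (Fin 2) ℂ) (c : ℂ) : MvPowerSeries (Fin 2) ℂ :=
  expSum (twistedField h c) 1

theorem twistedFlow_add {h : MvPowerSeries (Fin 2) ℂ} (hh : ∀ n, cf h n 0 = 0) (a b : ℂ) :
    twistedFlow h (a + b) = twistedFlow h a * twistedFlow h b := by
  rw [twistedFlow, ← one_mul (1 : MvPowerSeries (Fin 2) ℂ), expSum_mul hh]; rfl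

theorem twistedFlow_zero {h : MvPowerSeries (Fin 2) ℂ} (hh : ∀ n, cf h n 0 = 0) :
    twistedFlow h 0 = 1 := by
  refine (coeffSum_expSum hh 0 1).unique fun n k => ?_
  convert hasSum_single 0 ?_ using 1
  · simp [expTerm]
  · intro N hN
    obtain ⟨M, rfl⟩ := Nat.exists_eq_succ_of_ne_zero hN
    have h0 : (⇑(twistedField h 0))^[M] 0 = 0 := Function.iterate_fixed (map_zero _) M
    rw [expTerm, Function.iterate_succ_apply, twistedField_zero_apply, hamiltonianField,
      zdz_one, ds_one, mul_zero, mul_zero, sub_zero, h0, smul_zero]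
    exact map_zero _

theorem expTerm_intertwine {L L' T : MvPowerSeries (Fin 2) ℂ →ₗ[ℂ] MvPowerSeries (Fin 2) ℂ}
    (h : ∀ f, L (T f) = T (L' f)) (f : MvPowerSeries (Fin 2) ℂ) (N : ℕ) :
    expTerm L (T f) N = T (expTerm L' f N) := by
  have : L^[N] (T f) = T (L'^[N] f) :=
    (Function.Semiconj.iterate_right (f := T) (ga := L') (gb := L) (fun f => (h f).symm) N f).symm
  rw [expTerm, expTerm, this, map_smul]

theorem Xi_one {h : MvPowerSeries (Fin 2) ℂ} (hh : ∀ n, cf h n 0 = 0) :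
    Xi h 1 = MvPowerSeries.X 0 * twistedFlow h (-1) := by
  rw [Xi, flow_one]
  refine (coeffSum_expSum hh 0 _).unique fun n k => ?_
  have h1 := expTerm_intertwine (L := twistedField h 0) (L' := twistedField h (-1))
    (T := LinearMap.mulLeft ℂ (MvPowerSeries.X 0)) (fun f => by
      simp only [LinearMap.mulLeft_apply, twistedField_apply, hamiltonianField, zdz_mul, ds_mul,
        zdz_X_zero, ds_X_zero, zero_smul, neg_smul, one_smul]
      ring) 1
  simp only [LinearMap.mulLeft_apply, mul_one] at h1
  simp only [h1]
  cases n with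
  | zero => simp
  | succ n => simpa [twistedFlow] using coeffSum_expSum hh (-1) 1 n k

theorem poisson_Xi_Upsilon {h : MvPowerSeries (Fin 2) ℂ} (hh : ∀ n, cf h n 0 = 0) :
    poisson (Xi h 1) (Upsilon h 1) = Xi h 1 := by
  rw [Xi, Upsilon, flow_one, flow_one, ← expSum_poisson hh, poisson_apply, zdz_X_zero, ds_X_one,
    ds_X_zero, mul_one, zero_mul, sub_zero]

/-- The time-one flow preserves `dz/z ∧ ds`. -/
theorem jacobian_eq_one {h : MvPowerSeries (Fin 2) ℂ} (hh : ∀ n, cf h n 0 = 0) :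
    ds (Upsilon h 1) * (1 + zdz (twistedFlow h (-1)) * twistedFlow h 1)
      - ds (twistedFlow h (-1)) * twistedFlow h 1 * zdz (Upsilon h 1) = 1 := by
  have h1 := poisson_Xi_Upsilon hh
  have h2 : twistedFlow h (-1) * twistedFlow h 1 = 1 := by
    rw [← twistedFlow_add hh, neg_add_cancel, twistedFlow_zero hh]
  rw [poisson_apply, Xi_one hh, zdz_mul, ds_mul, zdz_X_zero, ds_X_zero] at h1
  have h3 : (MvPowerSeries.X 0 : MvPowerSeries (Fin 2) ℂ) ≠ 0 := fun h0 => by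
    have h := cf_X_zero 1 0
    rw [h0] at h
    simp [cf] at h
  have h4 := mul_left_cancel₀ (b := (twistedFlow h (-1) + zdz (twistedFlow h (-1)))
    * ds (Upsilon h 1) - ds (twistedFlow h (-1)) * zdz (Upsilon h 1)) h3 (by rw [← h1]; ring)
  linear_combination twistedFlow h 1 * h4 + (1 - ds (Upsilon h 1)) * h2

theorem cf_Upsilon_zero {h : MvPowerSeries (Fin 2) ℂ} (hh : ∀ n, cf h n 0 = 0) (n : ℕ) :
    cf (Upsilon h 1) n 0 = 0 := by
  have h1 : ∀ N n, cf ((twistedField h 0)^[N] (MvPowerSeries.X 1)) n 0 = 0 := by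
    intro N
    induction N with
    | zero => intro n; simp [cf_X_one]
    | succ N ih =>
      intro n
      rw [Function.iterate_succ_apply', cf_twistedField_of_dvd hh]
      refine Finset.sum_eq_zero fun x hx => ?_
      simp only [Finset.mem_product, Finset.mem_range] at hx
      obtain ⟨a, b⟩ := x
      obtain rfl : b = 0 := by omega
      rw [ih, mul_zero]
  rw [Upsilon, flow_one]
  refine (coeffSum_expSum hh 0 _ n 0).unique ?_
  simp [expTerm, h1]

/-! ## Restriction to curves -/

/-- The coefficient of `s^k` in `f(z, s)`. -/
def slice (k : ℕ) (f : MvPowerSeries (Fin 2) ℂ) : ℂ⟦X⟧ := PowerSeries.mk fun n => cf f n k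

@[simp] theorem coeff_slice (k n : ℕ) (f : MvPowerSeries (Fin 2) ℂ) :
    PowerSeries.coeff n (slice k f) = cf f n k := PowerSeries.coeff_mk _ _

/-- Pairs of exponents as finitely supported functions. -/
def bidegreeEquiv : ℕ × ℕ ≃ (Fin 2 →₀ ℕ) where
  toFun x := bidegree x.1 x.2
  invFun e := (e 0, e 1)
  left_inv x := by simp
  right_inv e := bidegree_eta e

theorem hasSubst_curve {A : ℂ⟦X⟧} (hA : PowerSeries.constantCoeff A = 0) :
    MvPowerSeries.HasSubst ![(PowerSeries.X : ℂ⟦X⟧), A] := by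
  refine MvPowerSeries.hasSubst_of_constantCoeff_zero fun i => ?_
  fin_cases i
  · exact PowerSeries.constantCoeff_X
  · exact hA

theorem coeff_mul_pow_eq_zero {A : ℂ⟦X⟧} (hA : PowerSeries.constantCoeff A = 0) {n k : ℕ}
    (h : n < k) (f : ℂ⟦X⟧) : PowerSeries.coeff n (f * A ^ k) = 0 := by
  obtain ⟨B, rfl⟩ := PowerSeries.X_dvd_iff.2 hA
  rw [mul_pow, mul_left_comm]
  exact PowerSeries.X_pow_dvd_iff.1 (Dvd.intro _ rfl) n h

theorem coeff_evalCurve {A : ℂ⟦X⟧} (hA : PowerSeries.constantCoeff A = 0)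
    (f : MvPowerSeries (Fin 2) ℂ) {n m : ℕ} (hnm : n ≤ m) :
    PowerSeries.coeff n (evalCurve f A)
      = PowerSeries.coeff n (∑ k ∈ Finset.range (m + 1), slice k f * A ^ k) := by
  have h1 : PowerSeries.coeff n (evalCurve f A) = ∑ᶠ x : ℕ × ℕ,
      cf f x.1 x.2 * PowerSeries.coeff n (PowerSeries.X ^ x.1 * A ^ x.2) := by
    rw [PowerSeries.coeff, evalCurve, MvPowerSeries.coeff_subst (hasSubst_curve hA),
      ← finsum_comp_equiv bidegreeEquiv]
    refine finsum_congr fun x => ?_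
    rw [smul_eq_mul, Finsupp.prod_fintype _ _ (fun _ => pow_zero _), Fin.prod_univ_two]
    simp [bidegreeEquiv, cf, PowerSeries.coeff]
  rw [h1, finsum_eq_sum_of_support_subset
    (s := Finset.range (n + 1) ×ˢ Finset.range (m + 1)), Finset.sum_product_right, map_sum]
  · refine Finset.sum_congr rfl fun k _ => ?_
    rw [PowerSeries.coeff_mul, Finset.Nat.sum_antidiagonal_eq_sum_range_succ_mk]
    refine Finset.sum_congr rfl fun p hp => ?_
    rw [PowerSeries.coeff_X_pow_mul', if_pos (by simpa [Nat.lt_succ_iff] using hp), coeff_slice]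
  · rintro ⟨p, k⟩ hx
    rw [Function.mem_support] at hx
    simp only [Finset.coe_product, Finset.coe_range, Set.mem_prod, Set.mem_Iio]
    by_contra hcon
    apply hx
    rcases lt_or_ge n k with hk | hk
    · rw [coeff_mul_pow_eq_zero hA hk, mul_zero]
    · rw [PowerSeries.coeff_X_pow_mul', if_neg (by simp only; omega), mul_zero]

theorem coeff_evalCurve_mul {A : ℂ⟦X⟧} (hA : PowerSeries.constantCoeff A = 0)
    (f : MvPowerSeries (Fin 2) ℂ) (B : ℂ⟦X⟧) (n : ℕ) :
    PowerSeries.coeff n (evalCurve f A * B)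
      = PowerSeries.coeff n ((∑ k ∈ Finset.range (n + 1), slice k f * A ^ k) * B) := by
  rw [PowerSeries.coeff_mul, PowerSeries.coeff_mul]
  refine Finset.sum_congr rfl fun x hx => ?_
  rw [mem_antidiagonal] at hx
  rw [coeff_evalCurve hA f (show x.1 ≤ n by omega)]

/-- The Euler operator `z d/dz`. -/
def euler (f : ℂ⟦X⟧) : ℂ⟦X⟧ := PowerSeries.X * PowerSeries.derivative ℂ f

theorem coeff_euler (f : ℂ⟦X⟧) (n : ℕ) :
    PowerSeries.coeff n (euler f) = n * PowerSeries.coeff n f := by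
  cases n with
  | zero => simp [euler]
  | succ n =>
    rw [euler, PowerSeries.coeff_succ_X_mul, PowerSeries.coeff_derivative, mul_comm]
    push_cast; rfl

theorem euler_mul (f g : ℂ⟦X⟧) : euler (f * g) = euler f * g + f * euler g := by
  simp only [euler, Derivation.leibniz, smul_eq_mul]; ring

theorem euler_pow_succ (f : ℂ⟦X⟧) (n : ℕ) :
    euler (f ^ (n + 1)) = ((n : ℂ⟦X⟧) + 1) * f ^ n * euler f := by
  simp only [euler, Derivation.leibniz_pow, nsmul_eq_mul, smul_eq_mul, Nat.add_sub_cancel]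
  push_cast; ring

theorem euler_sum {ι : Type*} (s : Finset ι) (f : ι → ℂ⟦X⟧) :
    euler (∑ i ∈ s, f i) = ∑ i ∈ s, euler (f i) := by
  simp [euler, Finset.mul_sum]

theorem euler_slice (k : ℕ) (f : MvPowerSeries (Fin 2) ℂ) :
    euler (slice k f) = slice k (zdz f) := by
  ext n
  rw [coeff_euler, coeff_slice, coeff_slice, cf_zdz]

theorem slice_ds (k : ℕ) (f : MvPowerSeries (Fin 2) ℂ) :
    slice k (ds f) = ((k : ℂ⟦X⟧) + 1) * slice (k + 1) f := by
  ext n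
  have : (k : ℂ⟦X⟧) + 1 = PowerSeries.C ((k : ℂ) + 1) := by simp
  rw [this, PowerSeries.coeff_C_mul, coeff_slice, coeff_slice, cf_ds]

theorem euler_evalCurve {A : ℂ⟦X⟧} (hA : PowerSeries.constantCoeff A = 0)
    (f : MvPowerSeries (Fin 2) ℂ) :
    euler (evalCurve f A) = evalCurve (zdz f) A + evalCurve (ds f) A * euler A := by
  ext n
  rw [coeff_euler, coeff_evalCurve hA f le_rfl, ← coeff_euler, map_add,
    coeff_evalCurve hA (zdz f) le_rfl, coeff_evalCurve_mul hA, euler_sum, ← map_add]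
  simp only [euler_mul, euler_slice, Finset.sum_add_distrib, map_add]
  congr 1
  rw [Finset.sum_range_succ', Finset.sum_mul, Finset.sum_range_succ, map_add, map_add]
  have h1 : euler A * A ^ n = A ^ n * euler A := mul_comm _ _
  have h2 : PowerSeries.coeff n (slice n (ds f) * A ^ n * euler A) = 0 := by
    have h3 : euler A = PowerSeries.X * PowerSeries.derivative ℂ A := rfl
    obtain ⟨B, hB⟩ := PowerSeries.X_dvd_iff.2 hA
    have : slice n (ds f) * A ^ n * euler A = PowerSeries.X ^ (n + 1) *
        (slice n (ds f) * B ^ n * PowerSeries.derivative ℂ A) := by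
      rw [h3]; nth_rewrite 1 [hB]; ring
    rw [this]
    exact PowerSeries.X_pow_dvd_iff.1 (Dvd.intro _ rfl) n n.lt_succ_self
  rw [h2]
  congr 2
  · refine Finset.sum_congr rfl fun k _ => ?_
    rw [euler_pow_succ, slice_ds]; ring
  · simp [euler]

/-! ## Residues -/

/-- An antiderivative with respect to `s`. -/
def integralS (f : MvPowerSeries (Fin 2) ℂ) : MvPowerSeries (Fin 2) ℂ :=
  fun e => if e 1 = 0 then 0 else cf f (e 0) (e 1 - 1) / (e 1 : ℂ)

theorem cf_integralS (f : MvPowerSeries (Fin 2) ℂ) (n k : ℕ) :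
    cf (integralS f) n k = if k = 0 then 0 else cf f n (k - 1) / (k : ℂ) := by
  change (if bidegree n k 1 = 0 then 0 else
    cf f (bidegree n k 0) (bidegree n k 1 - 1) / (bidegree n k 1 : ℂ)) = _
  simp

theorem ds_integralS (f : MvPowerSeries (Fin 2) ℂ) : ds (integralS f) = f := by
  refine cf_ext fun n k => ?_
  have : (k : ℂ) + 1 ≠ 0 := by exact_mod_cast k.succ_ne_zero
  rw [cf_ds, cf_integralS, if_neg k.succ_ne_zero]
  push_cast
  rw [mul_div_cancel₀ _ this]

/-- Stokes' formula for the residue of `z^{-m} (P dz/z + Q ds)` along a curve `s = A(z)`. -/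
theorem coeff_evalCurve_form {A : ℂ⟦X⟧} (hA : PowerSeries.constantCoeff A = 0)
    {P Q U : MvPowerSeries (Fin 2) ℂ} (m : ℕ) (hU : ds P - zdz Q + (m : ℂ) • Q = U)
    (hP : ∀ n, cf P n 0 = 0) :
    PowerSeries.coeff m (evalCurve P A + evalCurve Q A * euler A)
      = ∑ M ∈ Finset.range m,
        1 / ((M : ℂ) + 1) * PowerSeries.coeff m (A ^ (M + 1) * slice M U) := by
  have hs := hasSubst_curve hA
  set R := P + (m : ℂ) • integralS Q - zdz (integralS Q) with hR
  have h1 : PowerSeries.coeff m (evalCurve P A + evalCurve Q A * euler A)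
      = PowerSeries.coeff m (evalCurve R A) := by
    have h2 := congrArg (PowerSeries.coeff m) (euler_evalCurve hA (integralS Q))
    rw [coeff_euler, ds_integralS] at h2
    rw [hR, evalCurve, evalCurve, evalCurve, MvPowerSeries.subst_sub hs,
      MvPowerSeries.subst_add hs, MvPowerSeries.subst_smul hs, map_sub, map_add, map_add, map_smul]
    simp only [evalCurve, map_add] at h2
    rw [smul_eq_mul, h2]; ring
  have h3 : ∀ n, cf R n 0 = 0 := by
    intro n; simp [hR, hP, cf_integralS]
  have h4 : ∀ k, slice (k + 1) R = PowerSeries.C (1 / ((k : ℂ) + 1)) * slice k U := by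
    intro k
    ext n
    have hk : (k : ℂ) + 1 ≠ 0 := by exact_mod_cast k.succ_ne_zero
    rw [PowerSeries.coeff_C_mul, coeff_slice, coeff_slice, ← hU, hR]
    simp only [cf_sub, cf_add, cf_smul, cf_zdz, cf_integralS, cf_ds]
    rw [if_neg k.succ_ne_zero]
    push_cast
    field_simp
    ring
  rw [h1, coeff_evalCurve hA R le_rfl, Finset.sum_range_succ', map_add, map_sum]
  have h5 : slice 0 R = 0 := by ext n; simp [h3]
  rw [h5, zero_mul, map_zero, add_zero]
  refine Finset.sum_congr rfl fun k _ => ?_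
  rw [h4, mul_assoc, PowerSeries.coeff_C_mul, mul_comm (A ^ _)]

/-- The residue of `y X^{-m} dX / X` for `X = z h` and `u = h⁻¹`. -/
def residue (h u : ℂ⟦X⟧) (m : ℕ) (y : ℂ⟦X⟧) : ℂ :=
  PowerSeries.coeff m (y * ((1 + euler h * u) * u ^ m))

theorem residue_X_mul_pow {h u : ℂ⟦X⟧} (hu : h * u = 1) (m k : ℕ) :
    residue h u m ((PowerSeries.X * h) ^ k) = if k = m then 1 else 0 := by
  rw [residue]
  rcases lt_or_ge m k with hk | hk
  · rw [if_neg hk.ne', mul_pow, mul_assoc]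
    exact PowerSeries.X_pow_dvd_iff.1 (Dvd.intro _ rfl) m hk
  obtain ⟨n, rfl⟩ := Nat.exists_eq_add_of_le hk
  have h1 : (PowerSeries.X * h) ^ k * ((1 + euler h * u) * u ^ (k + n))
      = PowerSeries.X ^ k * ((1 + euler h * u) * u ^ n) := by
    have : h ^ k * u ^ k = 1 := by rw [← mul_pow, hu, one_pow]
    rw [mul_pow, pow_add]
    linear_combination PowerSeries.X ^ k * (1 + euler h * u) * u ^ n * this
  rw [h1, PowerSeries.coeff_X_pow_mul', if_pos (by omega), Nat.add_sub_cancel_left]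
  cases n with
  | zero => simp [euler]
  | succ n =>
    rw [if_neg (by omega)]
    have h2 : euler h * u + h * euler u = 0 := by
      rw [← euler_mul, hu]; simp [euler]
    have hn : (n : ℂ) + 1 ≠ 0 := by exact_mod_cast n.succ_ne_zero
    apply mul_left_cancel₀ hn
    have h3 : (1 + euler h * u) * u ^ (n + 1) = u ^ (n + 1) - u ^ n * euler u := by
      linear_combination u ^ (n + 1) * h2 - u ^ n * euler u * hu
    have h4 : ((n : ℂ) + 1) * PowerSeries.coeff (n + 1) (u ^ n * euler u)
        = ((n : ℂ) + 1) * PowerSeries.coeff (n + 1) (u ^ (n + 1)) := by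
      have h5 := coeff_euler (u ^ (n + 1)) (n + 1)
      have h6 : (n : ℂ⟦X⟧) + 1 = PowerSeries.C ((n : ℂ) + 1) := by simp
      rw [euler_pow_succ, mul_assoc, h6, PowerSeries.coeff_C_mul] at h5
      rw [h5]; push_cast; rfl
    rw [h3, map_sub, mul_sub, h4, sub_self, mul_zero]

theorem eq_zero_of_residue_eq_zero {h u y : ℂ⟦X⟧} (hu : h * u = 1)
    (hy : ∀ m, residue h u m y = 0) : y = 0 := by
  ext m
  rw [map_zero]
  induction m using Nat.strong_induction_on with
  | _ m ih =>
    have h1 := hy m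
    rw [residue, PowerSeries.coeff_mul, Finset.sum_eq_single (m, 0)] at h1
    · have h2 : PowerSeries.constantCoeff u ≠ 0 := by
        intro h0
        have := congrArg PowerSeries.constantCoeff hu
        simp [h0] at this
      simpa [euler, h2] using h1
    · rintro ⟨a, b⟩ hab hne
      rw [mem_antidiagonal] at hab
      have : a < m := by
        rcases eq_or_ne b 0 with rfl | hb
        · exact absurd (by simpa using hab) hne
        · simp only at hab; omega
      rw [ih a this, zero_mul]
    · intro hm
      exact absurd (by rw [mem_antidiagonal]; simp) hm

theorem coeff_subst_eq {b : ℂ⟦X⟧} (hb : PowerSeries.constantCoeff b = 0) (F : ℂ⟦X⟧) {n m : ℕ}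
    (hnm : n ≤ m) : PowerSeries.coeff n (F.subst b)
      = PowerSeries.coeff n (∑ d ∈ Finset.range (m + 1),
        PowerSeries.C (PowerSeries.coeff d F) * b ^ d) := by
  rw [PowerSeries.coeff_subst' (PowerSeries.HasSubst.of_constantCoeff_zero' hb),
    finsum_eq_sum_of_support_subset (s := Finset.range (m + 1)), map_sum]
  · simp [PowerSeries.coeff_C_mul]
  · intro d hd
    rw [Function.mem_support] at hd
    simp only [Finset.coe_range, Set.mem_Iio]
    by_contra hcon
    apply hd
    rw [← one_mul (b ^ d), coeff_mul_pow_eq_zero hb (by omega), smul_zero]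

theorem residue_subst {h u : ℂ⟦X⟧} (hu : h * u = 1) (F : ℂ⟦X⟧) (m : ℕ) :
    residue h u m (F.subst (PowerSeries.X * h)) = PowerSeries.coeff m F := by
  have hb : PowerSeries.constantCoeff (PowerSeries.X * h) = 0 := by simp
  have h1 : residue h u m (F.subst (PowerSeries.X * h)) = residue h u m
      (∑ d ∈ Finset.range (m + 1),
        PowerSeries.C (PowerSeries.coeff d F) * (PowerSeries.X * h) ^ d) := by
    rw [residue, residue, PowerSeries.coeff_mul, PowerSeries.coeff_mul]
    refine Finset.sum_congr rfl fun x hx => ?_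
    rw [mem_antidiagonal] at hx
    rw [coeff_subst_eq hb F (show x.1 ≤ m by omega)]
  rw [h1, residue, Finset.sum_mul, map_sum]
  simp only [mul_assoc (PowerSeries.C _), PowerSeries.coeff_C_mul]
  change ∑ d ∈ Finset.range (m + 1), PowerSeries.coeff d F
    * residue h u m ((PowerSeries.X * h) ^ d) = _
  simp [residue_X_mul_pow hu]

theorem twistedFlow_natCast {h : MvPowerSeries (Fin 2) ℂ} (hh : ∀ n, cf h n 0 = 0) (m : ℕ) :
    twistedFlow h m = twistedFlow h 1 ^ m := by
  induction m with
  | zero => simp [twistedFlow_zero hh]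
  | succ m ih => rw [Nat.cast_succ, twistedFlow_add hh, ih, pow_succ]

theorem evalCurve_mul {A : ℂ⟦X⟧} (hA : PowerSeries.constantCoeff A = 0)
    (f g : MvPowerSeries (Fin 2) ℂ) :
    evalCurve (f * g) A = evalCurve f A * evalCurve g A :=
  MvPowerSeries.subst_mul (hasSubst_curve hA) f g

theorem evalCurve_add {A : ℂ⟦X⟧} (hA : PowerSeries.constantCoeff A = 0)
    (f g : MvPowerSeries (Fin 2) ℂ) :
    evalCurve (f + g) A = evalCurve f A + evalCurve g A :=
  MvPowerSeries.subst_add (hasSubst_curve hA) f g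

theorem evalCurve_one {A : ℂ⟦X⟧} (hA : PowerSeries.constantCoeff A = 0) :
    evalCurve 1 A = 1 := by
  rw [evalCurve, ← MvPowerSeries.coe_substAlgHom (hasSubst_curve hA), map_one]

theorem evalCurve_pow {A : ℂ⟦X⟧} (hA : PowerSeries.constantCoeff A = 0)
    (f : MvPowerSeries (Fin 2) ℂ) (n : ℕ) : evalCurve (f ^ n) A = evalCurve f A ^ n :=
  MvPowerSeries.subst_pow (hasSubst_curve hA) f n

theorem evalCurve_Xi {h : MvPowerSeries (Fin 2) ℂ} (hh : ∀ n, cf h n 0 = 0) {A : ℂ⟦X⟧}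
    (hA : PowerSeries.constantCoeff A = 0) :
    evalCurve (Xi h 1) A = PowerSeries.X * evalCurve (twistedFlow h (-1)) A := by
  rw [Xi_one hh, evalCurve_mul hA]
  congr 1
  exact MvPowerSeries.subst_X (hasSubst_curve hA) 0

theorem evalCurve_twistedFlow_mul {h : MvPowerSeries (Fin 2) ℂ} (hh : ∀ n, cf h n 0 = 0)
    {A : ℂ⟦X⟧} (hA : PowerSeries.constantCoeff A = 0) :
    evalCurve (twistedFlow h (-1)) A * evalCurve (twistedFlow h 1) A = 1 := by
  rw [← evalCurve_mul hA, ← twistedFlow_add hh, neg_add_cancel, twistedFlow_zero hh,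
    evalCurve_one hA]

theorem evalCurve_Upsilon_zero {h : MvPowerSeries (Fin 2) ℂ} (hh : ∀ n, cf h n 0 = 0) :
    evalCurve (Upsilon h 1) 0 = 0 := by
  ext n
  rw [coeff_evalCurve (map_zero _) _ le_rfl, Finset.sum_range_succ']
  have h5 : slice 0 (Upsilon h 1) = 0 := by ext n; simp [cf_Upsilon_zero hh]
  simp [h5]

/-- The image of the curve `s = A(z)` under the time-one flow, as a graph over the image of `z`. -/
theorem subst_evalCurve_Xi {h : MvPowerSeries (Fin 2) ℂ} (hh : ∀ n, cf h n 0 = 0) {A : ℂ⟦X⟧}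
    (hA : PowerSeries.constantCoeff A = 0) {F : ℂ⟦X⟧}
    (hF : ∀ m : ℕ, PowerSeries.coeff m F = ∑ M ∈ Finset.range m,
      1 / ((M : ℂ) + 1) * PowerSeries.coeff m (A ^ (M + 1) * slice M (twistedFlow h m))) :
    F.subst (evalCurve (Xi h 1) A) = evalCurve (Upsilon h 1) A := by
  have hu := evalCurve_twistedFlow_mul hh hA
  have hHU : twistedFlow h (-1) * twistedFlow h 1 = 1 := by
    rw [← twistedFlow_add hh, neg_add_cancel, twistedFlow_zero hh]
  have hJ := jacobian_eq_one hh
  rw [evalCurve_Xi hh hA, ← sub_eq_zero]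
  refine eq_zero_of_residue_eq_zero hu fun m => ?_
  have h1 := residue_subst hu F m
  rw [residue] at h1 ⊢
  rw [sub_mul, map_sub, h1, hF, sub_eq_zero]
  set H := twistedFlow h (-1)
  set U := twistedFlow h 1
  set Y := Upsilon h 1
  have h2 : evalCurve Y A * ((1 + euler (evalCurve H A) * evalCurve U A) * evalCurve U A ^ m)
      = evalCurve (Y * ((1 + zdz H * U) * U ^ m)) A
        + evalCurve (Y * (ds H * U * U ^ m)) A * euler A := by
    simp only [evalCurve_mul hA, evalCurve_add hA, evalCurve_one hA, evalCurve_pow hA,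
      euler_evalCurve hA]
    ring
  rw [h2, coeff_evalCurve_form hA m ?_ ?_]
  · have hd : ∀ δ : MvPowerSeries (Fin 2) ℂ → MvPowerSeries (Fin 2) ℂ,
        (∀ f g, δ (f * g) = δ f * g + f * δ g) → δ 1 = 0 →
        δ U = - U ^ 2 * δ H ∧ δ (U ^ m) = - (m : MvPowerSeries (Fin 2) ℂ) * U ^ m * U * δ H := by
      intro δ hδ hδ1
      have h3 : δ U = - U ^ 2 * δ H := by
        have := hδ H U
        rw [hHU, hδ1] at this
        linear_combination (-U) * this - δ U * hHU
      refine ⟨h3, ?_⟩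
      have hp : ∀ n : ℕ, δ (U ^ n) = - (n : MvPowerSeries (Fin 2) ℂ) * U ^ n * U * δ H := by
        intro n
        induction n with
        | zero => simp [hδ1]
        | succ n ih => rw [pow_succ, hδ, ih, h3]; push_cast; ring
      exact hp m
    obtain ⟨hz1, hz2⟩ := hd zdz zdz_mul zdz_one
    obtain ⟨hs1, hs2⟩ := hd ds ds_mul ds_one
    rw [twistedFlow_natCast hh, MvPowerSeries.smul_eq_C_mul, map_natCast]
    simp only [zdz_mul, ds_mul, ds_add, ds_one, hz1, hz2, hs1, hs2, ds_zdz]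
    linear_combination U ^ m * hJ
  · intro n
    rw [cf_mul]
    simp [Y, cf_Upsilon_zero hh]

/-! ## Symbols -/

theorem coeff_taylor_of_natDegree_le {P : Polynomial ℂ} {n : ℕ} (hP : P.natDegree ≤ n + 1)
    (r : ℂ) : (Polynomial.taylor r P).coeff n = P.coeff n + r * (n + 1) * P.coeff (n + 1) := by
  have h1 : (Polynomial.hasseDeriv n P).natDegree < 2 := by
    have := Polynomial.natDegree_hasseDeriv_le P n
    omega
  rw [Polynomial.taylor_coeff, Polynomial.eval_eq_sum_range' h1, Finset.sum_range_succ,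
    Finset.sum_range_one, Polynomial.hasseDeriv_coeff, Polynomial.hasseDeriv_coeff]
  have h2 : (1 + n).choose n = n + 1 := by rw [add_comm, Nat.choose_succ_self_right]
  rw [h2, zero_add, Nat.choose_self, add_comm 1 n]
  push_cast; ring

theorem natDegree_taylor_sub_le {P : Polynomial ℂ} {n : ℕ} (hP : P.natDegree ≤ n + 1) (r : ℂ) :
    (Polynomial.taylor r P - Polynomial.taylor (-r) P).natDegree ≤ n := by
  rw [Polynomial.natDegree_le_iff_coeff_eq_zero]
  intro N hN
  have h1 : P.natDegree ≤ N + 1 := by omega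
  rw [Polynomial.coeff_sub, coeff_taylor_of_natDegree_le h1, coeff_taylor_of_natDegree_le h1,
    Polynomial.coeff_eq_zero_of_natDegree_lt (show P.natDegree < N + 1 by omega)]
  ring

theorem coeff_taylor_sub {P : Polynomial ℂ} {n : ℕ} (hP : P.natDegree ≤ n + 1) (r : ℂ) :
    (Polynomial.taylor r P - Polynomial.taylor (-r) P).coeff n
      = 2 * r * (n + 1) * P.coeff (n + 1) := by
  rw [Polynomial.coeff_sub, coeff_taylor_of_natDegree_le hP, coeff_taylor_of_natDegree_le hP]
  ring

theorem coeff_taylor_top {P : Polynomial ℂ} {n : ℕ} (hP : P.natDegree ≤ n) (r : ℂ) :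
    (Polynomial.taylor r P).coeff n = P.coeff n := by
  rw [coeff_taylor_of_natDegree_le (by omega),
    Polynomial.coeff_eq_zero_of_natDegree_lt (show P.natDegree < n + 1 by omega), mul_zero,
    add_zero]

theorem taylor_eq_self_of_natDegree_le {P : Polynomial ℂ} (hP : P.natDegree ≤ 0) (r : ℂ) :
    Polynomial.taylor r P = P := by
  rw [Polynomial.eq_C_of_natDegree_le_zero hP, Polynomial.taylor_C]

theorem taylor_sub_mul_taylor {P Q : Polynomial ℂ} {a b k : ℕ} (hP : P.natDegree ≤ a)
    (hQ : Q.natDegree ≤ b) (hab : a + b = k + 1) (r s : ℂ) :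
    ((Polynomial.taylor r P - Polynomial.taylor (-r) P) * Polynomial.taylor s Q).natDegree ≤ k ∧
    ((Polynomial.taylor r P - Polynomial.taylor (-r) P) * Polynomial.taylor s Q).coeff k
      = 2 * r * a * P.coeff a * Q.coeff b := by
  have hQ' : (Polynomial.taylor s Q).natDegree ≤ b := by rwa [Polynomial.natDegree_taylor]
  cases a with
  | zero => simp [taylor_eq_self_of_natDegree_le hP]
  | succ a =>
    obtain rfl : k = a + b := by omega
    refine ⟨Polynomial.natDegree_mul_le_of_le (natDegree_taylor_sub_le hP r) hQ', ?_⟩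
    rw [Polynomial.coeff_mul_add_eq_of_natDegree_le (natDegree_taylor_sub_le hP r) hQ',
      coeff_taylor_sub hP, coeff_taylor_top hQ]
    push_cast; ring

/-- One summand of the Moyal bracket. -/
def moyalTerm (P Q : Polynomial ℂ) (r s : ℂ) : Polynomial ℂ :=
  Polynomial.taylor r P * Polynomial.taylor s Q
    - Polynomial.taylor (-s) Q * Polynomial.taylor (-r) P

theorem moyalTerm_eq (P Q : Polynomial ℂ) (r s : ℂ) :
    moyalTerm P Q r s =
      (Polynomial.taylor r P - Polynomial.taylor (-r) P) * Polynomial.taylor s Q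
      + (Polynomial.taylor s Q - Polynomial.taylor (-s) Q) * Polynomial.taylor (-r) P := by
  rw [moyalTerm]; ring

theorem natDegree_moyalTerm_le {P Q : Polynomial ℂ} {a b k : ℕ} (hP : P.natDegree ≤ a)
    (hQ : Q.natDegree ≤ b) (hab : a + b = k + 1) (r s : ℂ) :
    (moyalTerm P Q r s).natDegree ≤ k := by
  rw [moyalTerm_eq]
  exact Polynomial.natDegree_add_le_of_degree_le (taylor_sub_mul_taylor hP hQ hab r s).1
    (taylor_sub_mul_taylor hQ hP (by omega) s (-r)).1

theorem coeff_moyalTerm {P Q : Polynomial ℂ} {a b k : ℕ} (hP : P.natDegree ≤ a)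
    (hQ : Q.natDegree ≤ b) (hab : a + b = k + 1) (r s : ℂ) :
    (moyalTerm P Q r s).coeff k = 2 * (r * a + s * b) * (P.coeff a * Q.coeff b) := by
  rw [moyalTerm_eq, Polynomial.coeff_add, (taylor_sub_mul_taylor hP hQ hab r s).2,
    (taylor_sub_mul_taylor hQ hP (by omega) s (-r)).2]
  ring

/-- `α n k` is the coefficient of `z^n ħ^k` of the symbol of an operator, a polynomial in
`s / ħ` of degree at most `k`, and `F` collects the coefficients of the monomials `(s / ħ)^k ħ^k`. -/
def IsSymbol (α : ℕ → ℕ → Polynomial ℂ) (F : MvPowerSeries (Fin 2) ℂ) : Prop :=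
  ∀ n k, (α n k).natDegree ≤ k ∧ (α n k).coeff k = cf F n k

/-- The symbol of `ħ⁻¹ [z^{-m} α, u]`, without the factor `z^{-m}`. -/
def moyalBracket (m : ℕ) (u α : ℕ → ℕ → Polynomial ℂ) (n k : ℕ) : Polynomial ℂ :=
  ∑ p ∈ antidiagonal n, ∑ q ∈ antidiagonal (k + 1),
    moyalTerm (α p.1 q.1) (u p.2 q.2) (p.2 / 2) (-((p.1 - m) / 2))

theorem IsSymbol.moyalBracket {u α : ℕ → ℕ → Polynomial ℂ} {h F : MvPowerSeries (Fin 2) ℂ}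
    (hα : IsSymbol α F) (hu : IsSymbol u h) (m : ℕ) :
    IsSymbol (moyalBracket m u α) (twistedField h m F) := by
  intro n k
  constructor
  · refine Polynomial.natDegree_sum_le_of_forall_le _ _ fun p _ =>
      Polynomial.natDegree_sum_le_of_forall_le _ _ fun q hq => ?_
    rw [mem_antidiagonal] at hq
    exact natDegree_moyalTerm_le (hα _ _).1 (hu _ _).1 hq _ _
  · rw [LeakyHurwitz.moyalBracket, cf_twistedField, Polynomial.finsetSum_coeff]
    refine Finset.sum_congr rfl fun p _ => ?_
    rw [Polynomial.finsetSum_coeff]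
    refine Finset.sum_congr rfl fun q hq => ?_
    rw [mem_antidiagonal] at hq
    rw [coeff_moyalTerm (hα _ _).1 (hu _ _).1 hq, (hα _ _).2, (hu _ _).2]
    ring

/-- The value of a symbol. -/
def symbolValue (α : ℕ → Polynomial ℂ) (x : ℂ) : ℂ⟦X⟧ :=
  PowerSeries.mk fun k => (α k).eval x

theorem coeff_symbolValue (α : ℕ → Polynomial ℂ) (x : ℂ) (k : ℕ) :
    PowerSeries.coeff k (symbolValue α x) = (α k).eval x := PowerSeries.coeff_mk _ _

theorem symbolValue_moyal {α u : ℕ → Polynomial ℂ} (hα : (α 0).natDegree ≤ 0)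
    (hu : (u 0).natDegree ≤ 0) (x r s : ℂ) :
    symbolValue α (x + r) * symbolValue u (x + s) - symbolValue u (x - s) * symbolValue α (x - r)
      = PowerSeries.X * PowerSeries.mk fun k => (∑ q ∈ antidiagonal (k + 1),
        moyalTerm (α q.1) (u q.2) r s).eval x := by
  ext k
  rw [map_sub, mul_comm (symbolValue u _), PowerSeries.coeff_mul, PowerSeries.coeff_mul,
    ← Finset.sum_sub_distrib]
  have h1 : ∀ q : ℕ × ℕ, PowerSeries.coeff q.1 (symbolValue α (x + r))
        * PowerSeries.coeff q.2 (symbolValue u (x + s))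
      - PowerSeries.coeff q.1 (symbolValue α (x - r))
        * PowerSeries.coeff q.2 (symbolValue u (x - s))
      = (moyalTerm (α q.1) (u q.2) r s).eval x := by
    intro q
    rw [moyalTerm, Polynomial.eval_sub, Polynomial.eval_mul, Polynomial.eval_mul]
    simp only [coeff_symbolValue, Polynomial.taylor_eval, ← sub_eq_add_neg]
    ring
  simp only [h1]
  cases k with
  | zero =>
    simp only [PowerSeries.coeff_zero_X_mul, Finset.Nat.antidiagonal_zero, Finset.sum_singleton]
    rw [moyalTerm, taylor_eq_self_of_natDegree_le hα, taylor_eq_self_of_natDegree_le hu,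
      taylor_eq_self_of_natDegree_le hα, taylor_eq_self_of_natDegree_le hu]
    simp [mul_comm]
  | succ k =>
    rw [PowerSeries.coeff_succ_X_mul, PowerSeries.coeff_mk, Polynomial.eval_finsetSum]

/-- The matrix entries of the Weyl quantisation of `z^{-m} α`. -/
def entry (m : ℕ) (α : ℕ → ℕ → Polynomial ℂ) (i j : ℤ) : ℂ⟦X⟧ :=
  if j ≤ i + m then symbolValue (α (i - j + m).toNat) (((i : ℂ) + j + 1) / 2) else 0

theorem entry_of_lt (m : ℕ) (α : ℕ → ℕ → Polynomial ℂ) {i j : ℤ} (h : i + m < j) :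
    entry m α i j = 0 := if_neg (by omega)

theorem sum_left_eq_antidiagonal {M : Type*} [AddCommMonoid M] {m n : ℕ} {i l : ℤ} (hi : i < 0)
    (hl : 0 ≤ l) (hn : i - l + m = n) (g : ℤ → M) (hg : ∀ j, j < l ∨ i + m < j → g j = 0) :
    ∑ j ∈ Finset.Ico 0 (m : ℤ), g j = ∑ p ∈ antidiagonal n, g (l + p.2) := by
  rw [← Finset.sum_subset (s₁ := Finset.Icc l (i + m))]
  · symm
    refine Finset.sum_bij (fun p _ => l + p.2) ?_ ?_ ?_ (fun _ _ => rfl)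
    · rintro ⟨a, b⟩ h
      rw [mem_antidiagonal] at h
      rw [Finset.mem_Icc]
      simp only at h ⊢
      omega
    · rintro ⟨a, b⟩ h ⟨c, d⟩ h' hbd
      rw [mem_antidiagonal] at h h'
      simp only at h h' hbd
      rw [Prod.mk.injEq]
      omega
    · intro j hj
      rw [Finset.mem_Icc] at hj
      refine ⟨((i + m - j).toNat, (j - l).toNat), ?_, ?_⟩
      · rw [mem_antidiagonal]
        simp only
        omega
      · simp only
        omega
  · intro j hj
    rw [Finset.mem_Icc] at hj
    rw [Finset.mem_Ico]
    omega
  · intro j _ hj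
    rw [Finset.mem_Icc] at hj
    exact hg j (by omega)

theorem sum_right_eq_antidiagonal {M : Type*} [AddCommMonoid M] {m n : ℕ} {i l : ℤ} (hi : i < 0)
    (hl : 0 ≤ l) (hn : i - l + m = n) (g : ℤ → M) (hg : ∀ j, i < j ∨ j + m < l → g j = 0) :
    ∑ j ∈ Finset.Ico (-m : ℤ) 0, g j = ∑ p ∈ antidiagonal n, g (i - p.2) := by
  rw [← Finset.sum_subset (s₁ := Finset.Icc (l - m) i)]
  · symm
    refine Finset.sum_bij (fun p _ => i - p.2) ?_ ?_ ?_ (fun _ _ => rfl)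
    · rintro ⟨a, b⟩ h
      rw [mem_antidiagonal] at h
      rw [Finset.mem_Icc]
      simp only at h ⊢
      omega
    · rintro ⟨a, b⟩ h ⟨c, d⟩ h' hbd
      rw [mem_antidiagonal] at h h'
      simp only at h h' hbd
      rw [Prod.mk.injEq]
      omega
    · intro j hj
      rw [Finset.mem_Icc] at hj
      refine ⟨((j + m - l).toNat, (i - j).toNat), ?_, ?_⟩
      · rw [mem_antidiagonal]
        simp only
        omega
      · simp only
        omega
  · intro j hj
    rw [Finset.mem_Icc] at hj
    rw [Finset.mem_Ico]
    omega
  · intro j _ hj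
    rw [Finset.mem_Icc] at hj
    exact hg j (by omega)

/-- The off-diagonal block of a commutator of quantised symbols. -/
theorem entry_commutator {u α : ℕ → ℕ → Polynomial ℂ} {h F : MvPowerSeries (Fin 2) ℂ}
    (hα : IsSymbol α F) (hu : IsSymbol u h) (m : ℕ) {i l : ℤ} (hi : i < 0) (hl : 0 ≤ l) :
    ∑ j ∈ Finset.Ico 0 (m : ℤ), entry m α i j * entry 0 u j l
      - ∑ j ∈ Finset.Ico (-m : ℤ) 0, entry 0 u i j * entry m α j l
      = PowerSeries.X * entry m (moyalBracket m u α) i l := by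
  by_cases hil : l ≤ i + m
  · obtain ⟨n, hn⟩ := Int.eq_ofNat_of_zero_le (show 0 ≤ i - l + m by omega)
    rw [sum_left_eq_antidiagonal hi hl hn, sum_right_eq_antidiagonal hi hl hn,
      ← Finset.sum_sub_distrib]
    · have h1 : ∀ p ∈ antidiagonal n,
          entry m α i (l + p.2) * entry 0 u (l + p.2) l
            - entry 0 u i (i - p.2) * entry m α (i - p.2) l
          = PowerSeries.X * PowerSeries.mk fun k => (∑ q ∈ antidiagonal (k + 1),
              moyalTerm (α p.1 q.1) (u p.2 q.2) (p.2 / 2) (-((p.1 - m) / 2))).eval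
              (((i : ℂ) + l + 1) / 2) := by
        rintro ⟨a, b⟩ hp
        rw [mem_antidiagonal] at hp
        simp only at hp ⊢
        have hab : (a : ℂ) = i - l + m - b := by
          have : (a : ℤ) = i - l + m - b := by omega
          exact_mod_cast this
        rw [← symbolValue_moyal (α := α a) (u := u b) (hα a 0).1 (hu b 0).1]
        simp only [entry]
        rw [if_pos (by omega), if_pos (by omega), if_pos (by omega), if_pos (by omega)]
        have e1 : (i - (l + b) + m).toNat = a := by omega
        have e2 : (l + b - l + (0 : ℕ)).toNat = b := by omega
        have e3 : (i - (i - b) + (0 : ℕ)).toNat = b := by omega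
        have e4 : (i - b - l + m).toNat = a := by omega
        rw [e1, e2, e3, e4]
        congr 3 <;> · push_cast [hab]; ring
      rw [Finset.sum_congr rfl h1, ← Finset.mul_sum]
      congr 1
      rw [entry, if_pos hil]
      ext k
      have e : (i - l + m).toNat = n := by omega
      rw [map_sum, coeff_symbolValue, e, moyalBracket, Polynomial.eval_finsetSum]
      simp
    · rintro j (hj | hj)
      · rw [entry_of_lt 0 u (by omega), zero_mul]
      · rw [entry_of_lt m α hj, mul_zero]
    · rintro j (hj | hj)
      · rw [entry_of_lt 0 u (by omega), mul_zero]
      · rw [entry_of_lt m α hj, zero_mul]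
  · rw [entry_of_lt _ _ (not_le.1 hil), mul_zero, Finset.sum_eq_zero, Finset.sum_eq_zero, sub_zero]
    · intro j _
      rcases lt_or_ge i j with hj | hj
      · rw [entry_of_lt 0 u (by omega), zero_mul]
      · rw [entry_of_lt m α (by omega), mul_zero]
    · intro j _
      rcases lt_or_ge j l with hj | hj
      · rw [entry_of_lt 0 u (by omega), mul_zero]
      · rw [entry_of_lt m α (by omega), zero_mul]

theorem sum_box_eq_antidiagonal (m : ℕ) (G : ℕ → ℕ → ℂ) :
    ∑ i ∈ Finset.Ico (-m : ℤ) 0, ∑ j ∈ Finset.Ico 0 (m : ℤ),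
      (if j ≤ i + m then G (i - j + m).toNat (j - i).toNat else 0)
      = ∑ p ∈ antidiagonal m, (p.2 : ℂ) * G p.1 p.2 := by
  have h1 : ∀ a ∈ Finset.range m, ∑ j ∈ Finset.Ico 0 (m : ℤ),
      (if j ≤ (-(a : ℤ) - 1) + m then
        G (-(a : ℤ) - 1 - j + m).toNat (j - (-(a : ℤ) - 1)).toNat else 0)
      = ∑ d ∈ Finset.Ioc a m, G (m - d) d := by
    intro a ha
    rw [Finset.mem_range] at ha
    rw [← Finset.sum_filter]
    refine Finset.sum_bij' (fun j _ => (j + a + 1).toNat) (fun d _ => (d : ℤ) - a - 1)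
      ?_ ?_ ?_ ?_ ?_
    all_goals simp only [Finset.mem_filter, Finset.mem_Ico, Finset.mem_Ioc]
    · intro j hj; omega
    · intro d hd; omega
    · intro j hj; omega
    · intro d hd; omega
    · intro j hj
      congr 1 <;> omega
  have h2 : ∀ g : ℤ → ℂ, ∑ i ∈ Finset.Ico (-m : ℤ) 0, g i
      = ∑ a ∈ Finset.range m, g (-(a : ℤ) - 1) := by
    intro g
    refine Finset.sum_bij' (fun i _ => (-i - 1).toNat) (fun a _ => -(a : ℤ) - 1) ?_ ?_ ?_ ?_ ?_
    all_goals simp only [Finset.mem_Ico, Finset.mem_range]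
    · intro j hj; omega
    · intro d hd; omega
    · intro j hj; omega
    · intro d hd; omega
    · intro j hj
      congr 1; omega
  rw [h2, Finset.sum_congr rfl h1, Finset.sum_comm' (t' := Finset.range (m + 1))
    (s' := fun d => Finset.range d)]
  · rw [← Finset.Nat.sum_antidiagonal_swap, Finset.Nat.sum_antidiagonal_eq_sum_range_succ_mk]
    simp
  · intro a d
    simp only [Finset.mem_range, Finset.mem_Ioc]
    omega

/-- The leading order of the cocycle of two quantised symbols. -/
theorem sum_coeff_zero_entry {u α : ℕ → ℕ → Polynomial ℂ} {h F : MvPowerSeries (Fin 2) ℂ}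
    (hα : IsSymbol α F) (hu : IsSymbol u h) (m : ℕ) :
    ∑ i ∈ Finset.Ico (-m : ℤ) 0, ∑ j ∈ Finset.Ico 0 (m : ℤ),
      PowerSeries.coeff 0 (entry m α i j) * PowerSeries.coeff 0 (entry 0 u j i)
      = PowerSeries.coeff m (slice 0 F * euler (slice 0 h)) := by
  have h0 : ∀ {β : ℕ → ℕ → Polynomial ℂ} {G : MvPowerSeries (Fin 2) ℂ}, IsSymbol β G →
      ∀ n x, PowerSeries.coeff 0 (symbolValue (β n) x) = cf G n 0 := by
    intro β G hβ n x
    rw [coeff_symbolValue, Polynomial.eq_C_of_natDegree_le_zero (hβ n 0).1, Polynomial.eval_C,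
      (hβ n 0).2]
  rw [PowerSeries.coeff_mul]
  have h1 := sum_box_eq_antidiagonal m fun a b => cf F a 0 * cf h b 0
  refine Eq.trans ?_ (h1.trans ?_)
  · refine Finset.sum_congr rfl fun i hi => Finset.sum_congr rfl fun j hj => ?_
    rw [Finset.mem_Ico] at hi hj
    simp only [entry]
    rw [if_pos (show i ≤ j + (0 : ℕ) by omega)]
    split_ifs with hij
    · rw [h0 hα, h0 hu]; simp
    · simp
  · refine Finset.sum_congr rfl fun p _ => ?_
    rw [coeff_euler, coeff_slice, coeff_slice]
    ring

/-! ## Anticommutation relations -/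

namespace Maya

@[simp] theorem mem_insert (T : Maya) (i n : ℤ) :
    n ∈ (T.insert i).carrier ↔ n = i ∨ n ∈ T.carrier := Iff.rfl

@[simp] theorem mem_erase (T : Maya) (i n : ℤ) :
    n ∈ (T.erase i).carrier ↔ n ∈ T.carrier ∧ n ≠ i := Iff.rfl

@[simp] theorem mem_vac (n : ℤ) : n ∈ vac.carrier ↔ n < 0 := Iff.rfl

theorem ext_mem {S T : Maya} (h : ∀ n, n ∈ S.carrier ↔ n ∈ T.carrier) : S = T :=
  Maya.ext (Set.ext h)

theorem finite_gt (T : Maya) (i : ℤ) : {n | n ∈ T.carrier ∧ i < n}.Finite := by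
  refine (T.finite_pos.union (Set.finite_Ioo i 0)).subset ?_
  rintro n ⟨hn, hi⟩
  rcases lt_or_ge n 0 with h | h
  · exact Or.inr ⟨hi, h⟩
  · exact Or.inl ⟨hn, h⟩

theorem sign_mul_self (T : Maya) (i : ℤ) : T.sign i * T.sign i = 1 := by
  rw [sign, ← mul_pow]; simp

theorem sign_insert {T : Maya} {i : ℤ} (hi : i ∉ T.carrier) (j : ℤ) :
    (T.insert i).sign j = if j < i then -T.sign j else T.sign j := by
  rw [sign, sign]
  split_ifs with h
  · have : {n | n ∈ (T.insert i).carrier ∧ j < n}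
        = Insert.insert i {n | n ∈ T.carrier ∧ j < n} := by
      ext n
      simp only [mem_insert, Set.mem_ofPred_eq, Set.mem_insert_iff]
      constructor
      · rintro ⟨rfl | hn, hj⟩
        · exact Or.inl rfl
        · exact Or.inr ⟨hn, hj⟩
      · rintro (rfl | ⟨hn, hj⟩)
        · exact ⟨Or.inl rfl, h⟩
        · exact ⟨Or.inr hn, hj⟩
    rw [this, Set.ncard_insert_of_notMem (fun hn => hi hn.1) (T.finite_gt j), pow_succ]
    ring
  · congr 2
    ext n
    simp only [mem_insert, Set.mem_ofPred_eq]
    constructor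
    · rintro ⟨rfl | hn, hj⟩
      · exact absurd hj h
      · exact ⟨hn, hj⟩
    · rintro ⟨hn, hj⟩
      exact ⟨Or.inr hn, hj⟩

theorem insert_erase_self {T : Maya} {i : ℤ} (hi : i ∈ T.carrier) : (T.erase i).insert i = T := by
  refine ext_mem fun n => ?_
  simp only [mem_insert, mem_erase]
  constructor
  · rintro (rfl | h)
    exacts [hi, h.1]
  · intro h
    by_cases hn : n = i
    exacts [Or.inl hn, Or.inr ⟨h, hn⟩]

theorem erase_insert_self {T : Maya} {i : ℤ} (hi : i ∉ T.carrier) : (T.insert i).erase i = T := by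
  refine ext_mem fun n => ?_
  simp only [mem_insert, mem_erase]
  constructor
  · rintro ⟨rfl | h, hn⟩
    exacts [absurd rfl hn, h]
  · intro h
    exact ⟨Or.inr h, fun hn => hi (hn ▸ h)⟩

theorem erase_erase_comm (T : Maya) (i j : ℤ) : (T.erase i).erase j = (T.erase j).erase i :=
  ext_mem fun n => by simp only [mem_erase]; tauto

theorem insert_insert_comm (T : Maya) (i j : ℤ) : (T.insert i).insert j = (T.insert j).insert i :=
  ext_mem fun n => by simp only [mem_insert]; tauto

theorem insert_erase_comm (T : Maya) {i j : ℤ} (h : i ≠ j) :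
    (T.erase i).insert j = (T.insert j).erase i := by
  refine ext_mem fun n => ?_
  simp only [mem_insert, mem_erase]
  constructor
  · rintro (rfl | h')
    exacts [⟨Or.inl rfl, h.symm⟩, ⟨Or.inr h'.1, h'.2⟩]
  · rintro ⟨rfl | h', h''⟩
    exacts [Or.inl rfl, Or.inr ⟨h', h''⟩]

theorem sign_erase {T : Maya} {i : ℤ} (hi : i ∈ T.carrier) (j : ℤ) :
    (T.erase i).sign j = if j < i then -T.sign j else T.sign j := by
  have h := sign_insert (T := T.erase i) (i := i) (by simp) j
  rw [insert_erase_self hi] at h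
  rw [h]
  split_ifs <;> simp

end Maya

theorem psi_anticomm (i j : ℤ) (f : Fock) : psi i (psi j f) = -psi j (psi i f) := by
  funext T
  simp only [psi, Pi.neg_apply, Maya.mem_erase]
  rcases eq_or_ne i j with rfl | hij
  · simp
  by_cases hi : i ∈ T.carrier <;> by_cases hj : j ∈ T.carrier <;>
    simp [hi, hj, hij, hij.symm]
  rw [Maya.sign_erase hi, Maya.sign_erase hj, Maya.erase_erase_comm]
  rcases lt_or_gt_of_ne hij with h | h
  · rw [if_neg h.not_gt, if_pos h]; push_cast; ring
  · rw [if_pos h, if_neg h.not_gt]; push_cast; ring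

theorem psiStar_anticomm (i j : ℤ) (f : Fock) :
    psiStar i (psiStar j f) = -psiStar j (psiStar i f) := by
  funext T
  simp only [psiStar, Pi.neg_apply, Maya.mem_insert]
  rcases eq_or_ne i j with rfl | hij
  · simp
  by_cases hi : i ∈ T.carrier <;> by_cases hj : j ∈ T.carrier <;>
    simp [hi, hj, hij, hij.symm]
  rw [Maya.sign_insert hi, Maya.sign_insert hj, Maya.insert_insert_comm]
  rcases lt_or_gt_of_ne hij with h | h
  · rw [if_neg h.not_gt, if_pos h]; push_cast; ring
  · rw [if_pos h, if_neg h.not_gt]; push_cast; ring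

theorem psiStar_psi (j k : ℤ) (f : Fock) :
    psiStar j (psi k f) = (if j = k then f else 0) - psi k (psiStar j f) := by
  funext T
  rcases eq_or_ne j k with rfl | hjk
  · simp only [psi, psiStar, Pi.sub_apply, if_true]
    by_cases hj : j ∈ T.carrier
    · simp only [hj, if_true, Maya.mem_erase, ne_eq, not_true_eq_false, and_false, if_false]
      rw [Maya.insert_erase_self hj, Maya.sign_erase hj, if_neg (lt_irrefl _), smul_smul,
        Maya.sign_mul_self, one_smul, sub_self]
    · simp only [hj, if_false, Maya.mem_insert, true_or, if_true]
      rw [Maya.erase_insert_self hj, Maya.sign_insert hj, if_neg (lt_irrefl _), smul_smul,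
        Maya.sign_mul_self, one_smul, sub_zero]
  · simp only [psi, psiStar, Pi.sub_apply, if_neg hjk, Maya.mem_insert, Maya.mem_erase]
    by_cases hj : j ∈ T.carrier <;> by_cases hk : k ∈ T.carrier <;>
      simp [hj, hk, hjk, hjk.symm]
    rw [Maya.sign_insert hj, Maya.sign_erase hk, Maya.insert_erase_comm _ hjk.symm]
    rcases lt_or_gt_of_ne hjk with h | h
    · rw [if_neg h.not_gt, if_pos h]; push_cast; ring
    · rw [if_pos h, if_neg h.not_gt]; push_cast; ring

theorem psi_neg (i : ℤ) (f : Fock) : psi i (-f) = -psi i f := by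
  funext T; simp only [psi, Pi.neg_apply]; split_ifs <;> simp

theorem psi_sub (i : ℤ) (f g : Fock) : psi i (f - g) = psi i f - psi i g := by
  funext T; simp only [psi, Pi.sub_apply]; split_ifs <;> simp [smul_sub]

theorem psi_zero (i : ℤ) : psi i 0 = 0 := by
  funext T; simp [psi]

theorem psiStar_sub (i : ℤ) (f g : Fock) : psiStar i (f - g) = psiStar i f - psiStar i g := by
  funext T; simp only [psiStar, Pi.sub_apply]; split_ifs <;> simp [smul_sub]

theorem psiStar_zero (i : ℤ) : psiStar i 0 = 0 := by
  funext T; simp [psiStar]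

/-- The commutator of two fermion bilinears. -/
theorem psi_psiStar_psi_psiStar (i j k l : ℤ) (f : Fock) :
    psi i (psiStar j (psi k (psiStar l f)))
      = (if j = k then psi i (psiStar l f) else 0) - (if l = i then psi k (psiStar j f) else 0)
        + psi k (psiStar l (psi i (psiStar j f))) := by
  have h1 := psiStar_psi l i (psiStar j f)
  have h2 : psi i (psi k (psiStar j (psiStar l f)))
      = (if l = i then psi k (psiStar j f) else 0) - psi k (psiStar l (psi i (psiStar j f))) := by
    rw [h1, psiStar_anticomm j l, psi_neg, psi_neg, psi_anticomm i k, neg_neg, psi_sub,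
      apply_ite (psi k), psi_zero, sub_sub_cancel]
  rw [psiStar_psi, psi_sub, h2, apply_ite (psi i), psi_zero]
  abel

/-! ## Hook coefficients -/

/-- The matrix element `⟨0| ψ_i ψ_j^* f`. -/
def hookCoeff (f : Fock) (i j : ℤ) : LaurentSeries ℂ := psi i (psiStar j f) Maya.vac

theorem hookCoeff_of_nonneg (f : Fock) {i : ℤ} (hi : 0 ≤ i) (j : ℤ) : hookCoeff f i j = 0 := by
  simp [hookCoeff, psi, not_lt.2 hi]

theorem hookCoeff_of_neg (f : Fock) {i j : ℤ} (hj : j < 0) (hij : j ≠ i) : hookCoeff f i j = 0 := by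
  simp [hookCoeff, psi, psiStar, hj, hij]

theorem hookCoeff_self (f : Fock) {i : ℤ} (hi : i < 0) : hookCoeff f i i = f Maya.vac := by
  simp only [hookCoeff, psi, psiStar, Maya.mem_vac, hi, if_true, Maya.mem_erase, ne_eq,
    not_true_eq_false, and_false, if_false]
  rw [Maya.insert_erase_self (T := Maya.vac) hi, Maya.sign_erase (T := Maya.vac) hi,
    if_neg (lt_irrefl _), smul_smul, Maya.sign_mul_self, one_smul]

theorem hookCoeff_eq_smul (f : Fock) {i j : ℤ} (hi : i < 0) (hj : 0 ≤ j) :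
    hookCoeff f i j = (Maya.vac.sign i * (Maya.vac.erase i).sign j)
      • f ((Maya.vac.erase i).insert j) := by
  simp [hookCoeff, psi, psiStar, hi, not_lt.2 hj, mul_assoc]

theorem E_vac_of_le (f : Fock) {k l : ℤ} (h : l ≤ k) : E k l f Maya.vac = 0 := by
  change hookCoeff f k l - (if k = l ∧ l < 0 then f else (0 : Fock)) Maya.vac = 0
  rcases lt_or_ge k 0 with hk | hk
  · rcases eq_or_ne l k with rfl | hne
    · rw [hookCoeff_self f hk, if_pos ⟨rfl, hk⟩, sub_self]
    · rw [hookCoeff_of_neg f (by omega) hne, if_neg (fun h => hne h.1.symm)]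
      simp
  · rw [hookCoeff_of_nonneg f hk, if_neg (by omega)]
    simp

theorem E_vac_of_lt (f : Fock) {k l : ℤ} (h : k < l) : E k l f Maya.vac = hookCoeff f k l := by
  change hookCoeff f k l - (if k = l ∧ l < 0 then f else (0 : Fock)) Maya.vac = hookCoeff f k l
  rw [if_neg (by omega)]
  simp

theorem hookCoeff_E (f : Fock) (i j : ℤ) {k l : ℤ} (h : l ≤ k) :
    hookCoeff (E k l f) i j
      = (if j = k then hookCoeff f i l else 0) - (if l = i then hookCoeff f k j else 0) := by
  have h1 := E_vac_of_le (psi i (psiStar j f)) h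
  rw [E, Pi.sub_apply, sub_eq_zero] at h1
  rw [hookCoeff, E, psiStar_sub, psi_sub, psi_psiStar_psi_psiStar, Pi.sub_apply, Pi.add_apply,
    Pi.sub_apply, h1]
  split_ifs <;> simp [psiStar_zero, psi_zero, hookCoeff]

theorem E_apply_of_ne (f : Fock) {k l : ℤ} (h : k ≠ l) (T : Maya) [Decidable (k ∈ T.carrier)]
    [Decidable (l ∈ T.carrier)] :
    E k l f T = if k ∈ T.carrier ∧ l ∉ T.carrier then
      (T.sign k * (T.erase k).sign l) • f ((T.erase k).insert l) else 0 := by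
  rw [E, if_neg (fun h' => h h'.1), sub_zero]
  simp only [psi, psiStar, Maya.mem_erase]
  by_cases hk : k ∈ T.carrier <;> by_cases hl : l ∈ T.carrier <;>
    simp [hk, hl, h.symm, mul_assoc]

theorem E_self_apply (f : Fock) (k : ℤ) (T : Maya) [Decidable (k ∈ T.carrier)] :
    E k k f T = (if k ∈ T.carrier then f T else 0) - (if k < 0 then f T else 0) := by
  rw [E, Pi.sub_apply]
  simp only [psi, psiStar, Maya.mem_erase]
  congr 1
  · by_cases hk : k ∈ T.carrier
    · simp only [hk, if_true, ne_eq, not_true_eq_false, and_false, if_false]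
      rw [Maya.insert_erase_self hk, Maya.sign_erase hk, if_neg (lt_irrefl _), smul_smul,
        Maya.sign_mul_self, one_smul]
    · simp [hk]
  · by_cases hk : k < 0 <;> simp [hk]

/-! ## Triangular operators -/

/-- Diagrams that agree with the vacuum outside `[-N, N)`. -/
def InBox (N : ℕ) (T : Maya) : Prop :=
  (∀ n : ℤ, n < -N → n ∈ T.carrier) ∧ ∀ n : ℤ, N ≤ n → n ∉ T.carrier

theorem exists_inBox (T : Maya) : ∃ N : ℕ, InBox N T := by
  obtain ⟨a, ha⟩ := T.finite_pos.bddAbove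
  obtain ⟨b, hb⟩ := T.finite_neg.bddBelow
  refine ⟨(max (a + 1) (-b)).toNat, fun n hn => ?_, fun n hn hT => ?_⟩
  · by_contra hT
    have := hb ⟨hT, by omega⟩
    omega
  · have := ha ⟨hT, by omega⟩
    omega

theorem InBox.move {N : ℕ} {T : Maya} (hT : InBox N T) {k l : ℤ} (hlk : l ≤ k)
    (hk : k ∈ T.carrier) (hl : l ∉ T.carrier) : InBox N ((T.erase k).insert l) := by
  have h1 : -(N : ℤ) ≤ l := by
    by_contra h; exact hl (hT.1 l (by omega))
  have h2 : k < N := by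
    by_contra h; exact hT.2 k (by omega) hk
  refine ⟨fun n hn => ?_, fun n hn => ?_⟩
  · simp only [Maya.mem_insert, Maya.mem_erase]
    exact Or.inr ⟨hT.1 n hn, by omega⟩
  · simp only [Maya.mem_insert, Maya.mem_erase, not_or, not_and]
    exact ⟨by omega, fun h => absurd h (hT.2 n hn)⟩

theorem inBox_vac (N : ℕ) : InBox N Maya.vac :=
  ⟨fun n hn => by simp only [Maya.mem_vac]; omega, fun n hn => by simp only [Maya.mem_vac]; omega⟩

theorem inBox_hook {m : ℕ} {i j : ℤ} (hi : i ∈ Finset.Ico (-m : ℤ) 0)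
    (hj : j ∈ Finset.Ico 0 (m : ℤ)) : InBox m ((Maya.vac.erase i).insert j) := by
  rw [Finset.mem_Ico] at hi hj
  refine ⟨fun n hn => ?_, fun n hn => ?_⟩
  all_goals simp only [Maya.mem_insert, Maya.mem_erase, Maya.mem_vac]; omega

theorem finite_inBox (N : ℕ) : {T | InBox N T}.Finite := by
  refine Set.Finite.of_injOn (f := fun T : Maya => T.carrier ∩ Set.Ico (-N : ℤ) N)
    (t := 𝒫 (Set.Ico (-N : ℤ) N)) (fun T _ => Set.inter_subset_right) ?_
    (Set.finite_Ico _ _).powerset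
  intro S hS T hT hST
  refine Maya.ext_mem fun n => ?_
  rcases lt_or_ge n (-N) with h | h
  · exact ⟨fun _ => hT.1 n h, fun _ => hS.1 n h⟩
  rcases lt_or_ge n N with h' | h'
  · have := Set.ext_iff.1 hST n
    simpa [h, h'] using this
  · exact ⟨fun h => absurd h (hS.2 n h'), fun h => absurd h (hT.2 n h')⟩

/-- The index square `[-N, N)²`. -/
def box (N : ℕ) : Finset (ℤ × ℤ) := Finset.Ico (-N : ℤ) N ×ˢ Finset.Ico (-N : ℤ) N

theorem mem_box {N : ℕ} {p : ℤ × ℤ} :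
    p ∈ box N ↔ (-N ≤ p.1 ∧ p.1 < N) ∧ (-N ≤ p.2 ∧ p.2 < N) := by
  simp [box]

theorem mem_box_of_E_ne_zero {N : ℕ} {T : Maya} (hT : InBox N T) {f : Fock} {k l : ℤ}
    (hlk : l ≤ k) (h : E k l f T ≠ 0) : (k, l) ∈ box N := by
  classical
  rw [mem_box]
  rcases eq_or_ne k l with rfl | hne
  · rw [E_self_apply] at h
    by_contra hcon
    apply h
    rcases lt_or_ge k (-N) with h1 | h1
    · rw [if_pos (hT.1 k h1), if_pos (by omega), sub_self]
    · have h2 : (N : ℤ) ≤ k := by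
        by_contra h3
        exact hcon ⟨⟨h1, by omega⟩, ⟨h1, by omega⟩⟩
      rw [if_neg (hT.2 k h2), if_neg (by omega), sub_self]
  · rw [E_apply_of_ne f hne] at h
    have h1 : k ∈ T.carrier ∧ l ∉ T.carrier := by
      by_contra hcon; exact h (if_neg hcon)
    have h2 : -(N : ℤ) ≤ l := by
      by_contra h'; exact h1.2 (hT.1 l (by omega))
    have h3 : k < N := by
      by_contra h'; exact hT.2 k (by omega) h1.1
    simp only
    omega

/-- Lower triangular matrices, which never lower the energy. -/
def Triangular (a : ℤ → ℤ → LaurentSeries ℂ) : Prop := ∀ k l, k < l → a k l = 0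

theorem ofMatrix_apply {a : ℤ → ℤ → LaurentSeries ℂ} (ha : Triangular a) (f : Fock) {N : ℕ}
    {T : Maya} (hT : InBox N T) :
    ofMatrix a f T = ∑ p ∈ box N, a p.1 p.2 * E p.1 p.2 f T := by
  rw [ofMatrix]
  refine finsum_eq_sum_of_support_subset _ fun p hp => ?_
  rw [Function.mem_support] at hp
  have h1 : p.2 ≤ p.1 := by
    by_contra h
    exact hp (by rw [ha _ _ (not_le.1 h), zero_mul])
  exact mem_box_of_E_ne_zero hT h1 fun h => hp (by rw [h, mul_zero])

theorem ofMatrix_vac {a : ℤ → ℤ → LaurentSeries ℂ} (ha : Triangular a) (f : Fock) :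
    ofMatrix a f Maya.vac = 0 := by
  rw [ofMatrix_apply ha f (inBox_vac 0)]
  rfl

theorem hookCoeff_ofMatrix {a : ℤ → ℤ → LaurentSeries ℂ} (ha : Triangular a) (f : Fock) {m : ℕ}
    {i j : ℤ} (hi : i ∈ Finset.Ico (-m : ℤ) 0) (hj : j ∈ Finset.Ico 0 (m : ℤ)) :
    hookCoeff (ofMatrix a f) i j = a j i * f Maya.vac
      + ∑ l ∈ Finset.Ico 0 (m : ℤ), a j l * hookCoeff f i l
      - ∑ k ∈ Finset.Ico (-m : ℤ) 0, a k i * hookCoeff f k j := by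
  have hT := inBox_hook hi hj
  rw [Finset.mem_Ico] at hi hj
  have h1 : hookCoeff (ofMatrix a f) i j = ∑ p ∈ box m, a p.1 p.2 *
      ((if j = p.1 then hookCoeff f i p.2 else 0)
        - (if p.2 = i then hookCoeff f p.1 j else 0)) := by
    rw [hookCoeff_eq_smul _ hi.2 hj.1, ofMatrix_apply ha f hT, Finset.smul_sum]
    refine Finset.sum_congr rfl fun p _ => ?_
    rcases lt_or_ge p.1 p.2 with h | h
    · simp [ha _ _ h]
    · rw [← hookCoeff_E f i j h, hookCoeff_eq_smul _ hi.2 hj.1, mul_smul_comm]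
  have h2 : Finset.Ico (-m : ℤ) m = Finset.Ico (-m : ℤ) 0 ∪ Finset.Ico 0 (m : ℤ) :=
    (Finset.Ico_union_Ico_eq_Ico (by omega) (by omega)).symm
  have h3 : Disjoint (Finset.Ico (-m : ℤ) 0) (Finset.Ico 0 (m : ℤ)) :=
    Finset.Ico_disjoint_Ico_consecutive _ _ _
  have h4 : ∑ l ∈ Finset.Ico (-m : ℤ) m, a j l * hookCoeff f i l = a j i * f Maya.vac
      + ∑ l ∈ Finset.Ico 0 (m : ℤ), a j l * hookCoeff f i l := by
    rw [h2, Finset.sum_union h3, Finset.sum_eq_single i]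
    · rw [hookCoeff_self f hi.2]
    · intro l hl hne
      rw [hookCoeff_of_neg f (Finset.mem_Ico.1 hl).2 hne, mul_zero]
    · intro h; exact absurd (Finset.mem_Ico.2 hi) h
  have h5 : ∑ k ∈ Finset.Ico (-m : ℤ) m, a k i * hookCoeff f k j
      = ∑ k ∈ Finset.Ico (-m : ℤ) 0, a k i * hookCoeff f k j := by
    rw [h2, Finset.sum_union h3, add_eq_left]
    refine Finset.sum_eq_zero fun k hk => ?_
    rw [hookCoeff_of_nonneg f (Finset.mem_Ico.1 hk).1, mul_zero]
  rw [h1, ← h4, ← h5, box, Finset.sum_product]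
  simp only [mul_sub, Finset.sum_sub_distrib, mul_ite, mul_zero]
  congr 1
  · rw [Finset.sum_comm]
    refine Finset.sum_congr rfl fun l _ => ?_
    rw [Finset.sum_ite_eq, if_pos (Finset.mem_Ico.2 ⟨by omega, by omega⟩)]
  · refine Finset.sum_congr rfl fun k _ => ?_
    rw [Finset.sum_ite_eq', if_pos (Finset.mem_Ico.2 ⟨by omega, by omega⟩)]

theorem covacuum_J (m : ℕ) (hm : m ≠ 0) (f : Fock) :
    covacuum (J m f) = ∑ j ∈ Finset.Ico 0 (m : ℤ), hookCoeff f (j - m) j := by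
  rw [covacuum, J, ofMatrix]
  have h1 : ∀ p : ℤ × ℤ, (if p.1 = p.2 - m then (1 : LaurentSeries ℂ) else 0)
      * E p.1 p.2 f Maya.vac = if p.1 = p.2 - m then hookCoeff f p.1 p.2 else 0 := by
    intro p
    split_ifs with h
    · rw [one_mul, E_vac_of_lt f (by omega)]
    · rw [zero_mul]
  simp only [h1]
  rw [finsum_eq_sum_of_support_subset (s := (Finset.Ico 0 (m : ℤ)).image fun j : ℤ => (j - (m : ℤ), j)),
    Finset.sum_image]
  · simp
  · intro a _ b _ hab
    exact (Prod.mk.inj hab).2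
  · rintro ⟨i, j⟩ hp
    rw [Function.mem_support] at hp
    simp only [Finset.coe_image, Set.mem_image, Finset.mem_coe, Finset.mem_Ico, Prod.mk.injEq]
    by_cases hij : i = j - m
    · rw [if_pos hij] at hp
      have hi : i < 0 := by
        by_contra h; exact hp (hookCoeff_of_nonneg f (not_lt.1 h) j)
      have hj : 0 ≤ j := by
        by_contra h; exact hp (hookCoeff_of_neg f (not_le.1 h) (by omega))
      exact ⟨j, ⟨hj, by omega⟩, hij.symm, rfl⟩
    · rw [if_neg hij] at hp
      exact absurd rfl hp

theorem hookCoeff_vacuum {i j : ℤ} (hi : i < 0) (hj : 0 ≤ j) : hookCoeff vacuum i j = 0 := by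
  rw [hookCoeff_eq_smul _ hi hj]
  have : (Maya.vac.erase i).insert j ≠ Maya.vac := by
    intro h
    have h1 : j ∈ ((Maya.vac.erase i).insert j).carrier := Or.inl rfl
    rw [h, Maya.mem_vac] at h1
    omega
  simp [vacuum, this]

theorem vacuum_vac : vacuum Maya.vac = 1 := by simp [vacuum]

/-! ## Quantised symbols as operators -/

/-- The matrix of the Weyl quantisation of `ħ⁻¹ u`. -/
def laurentMatrix (u : ℕ → ℕ → Polynomial ℂ) (i j : ℤ) : LaurentSeries ℂ :=
  hbarInv * HahnSeries.ofPowerSeries ℤ ℂ (entry 0 u i j)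

theorem triangular_laurentMatrix (u : ℕ → ℕ → Polynomial ℂ) : Triangular (laurentMatrix u) := by
  intro k l h
  rw [laurentMatrix, entry_of_lt 0 u (by omega), map_zero, mul_zero]

theorem coeff_neg_one_hbarInv_mul (x : ℂ⟦X⟧) :
    (hbarInv * HahnSeries.ofPowerSeries ℤ ℂ x).coeff (-1) = PowerSeries.coeff 0 x := by
  rw [hbarInv, HahnSeries.coeff_single_mul, PowerSeries.coeff_coe]
  simp

/-- The symbol of the cut-and-join operator `ħ W`. -/
def cutJoinSymbol (w : ℕ → PowerSeries (LaurentSeries ℂ)) (q k : ℕ) : Polynomial ℂ :=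
  ∑ r ∈ Finset.range (k + 1), Polynomial.monomial r (((w q).coeff r).coeff ((k : ℤ) - 1))

theorem cf_dequantisation (w : ℕ → PowerSeries (LaurentSeries ℂ)) (n k : ℕ) :
    cf (dequantisation w) n k = ((w n).coeff k).coeff ((k : ℤ) - 1) := by
  change ((PowerSeries.rescale hbarInv (w (bidegree n k 0))).coeff (bidegree n k 1)).coeff (-1) = _
  rw [bidegree_zero, bidegree_one, PowerSeries.coeff_rescale, hbarInv, HahnSeries.single_pow,
    HahnSeries.coeff_single_mul, one_pow, one_mul]
  congr 1
  simp only [nsmul_eq_mul]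
  ring

theorem isSymbol_cutJoin (w : ℕ → PowerSeries (LaurentSeries ℂ)) :
    IsSymbol (cutJoinSymbol w) (dequantisation w) := by
  intro n k
  constructor
  · refine Polynomial.natDegree_sum_le_of_forall_le _ _ fun r hr => ?_
    exact (Polynomial.natDegree_monomial_le _).trans (Nat.lt_succ_iff.1 (Finset.mem_range.1 hr))
  · rw [cutJoinSymbol, Polynomial.finsetSum_coeff, cf_dequantisation]
    simp only [Polynomial.coeff_monomial]
    rw [Finset.sum_ite_eq', if_pos (Finset.self_mem_range_succ k)]

theorem W_eq_ofMatrix (w : ℕ → PowerSeries (LaurentSeries ℂ)) :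
    W w = ofMatrix (laurentMatrix (cutJoinSymbol w)) := by
  rw [W]
  congr 1
  funext i j
  rw [laurentMatrix, entry]
  by_cases h : j ≤ i
  · rw [if_pos h, if_pos (by simpa using h)]
    ext n
    have hx : ((j : ℂ) + 1 / 2) + ((i : ℂ) - (j : ℂ)) / 2 = ((i : ℂ) + j + 1) / 2 := by ring
    rw [hbarInv, HahnSeries.coeff_single_mul, one_mul, PowerSeries.coeff_coe, evalAt,
      HahnSeries.coeff_ofSuppBddBelow, hx]
    split_ifs with hn
    · have : (n + 2).toNat = 0 := by omega
      rw [this, Finset.range_zero, Finset.sum_empty]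
    · obtain ⟨k, hk⟩ := Int.eq_ofNat_of_zero_le (not_lt.1 hn)
      have h1 : (n + 2).toNat = k + 1 := by omega
      have h2 : n = (k : ℤ) - 1 := by omega
      rw [h1, hk, Int.natAbs_natCast, coeff_symbolValue, cutJoinSymbol,
        Polynomial.eval_finsetSum, h2]
      refine Finset.sum_congr rfl fun r _ => ?_
      simp
  · rw [if_neg h, if_neg (by simpa using h), map_zero, mul_zero]

/-- The symbol of `ħ` times the secondary ramification operator. -/
def ramificationSymbol (s : ℕ+ → ℂ) (q k : ℕ) : Polynomial ℂ :=
  if k = 0 then Polynomial.C (PowerSeries.coeff q (ramificationSeries s) / q) else 0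

/-- The Hamiltonian `∑_q s_q z^q / q`. -/
def ramificationHamiltonian (s : ℕ+ → ℂ) : MvPowerSeries (Fin 2) ℂ :=
  fun e => if e 1 = 0 then PowerSeries.coeff (e 0) (ramificationSeries s) / (e 0 : ℂ) else 0

theorem cf_ramificationHamiltonian (s : ℕ+ → ℂ) (n k : ℕ) :
    cf (ramificationHamiltonian s) n k
      = if k = 0 then PowerSeries.coeff n (ramificationSeries s) / (n : ℂ) else 0 := by
  change (if bidegree n k 1 = 0 then PowerSeries.coeff (bidegree n k 0) (ramificationSeries s)
    / (bidegree n k 0 : ℂ) else 0) = _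
  simp

theorem isSymbol_ramification (s : ℕ+ → ℂ) :
    IsSymbol (ramificationSymbol s) (ramificationHamiltonian s) := by
  intro n k
  rw [ramificationSymbol, cf_ramificationHamiltonian]
  split_ifs with h
  · subst h
    simp
  · simp

theorem coeff_zero_ramificationSeries (s : ℕ+ → ℂ) :
    PowerSeries.coeff 0 (ramificationSeries s) = 0 := by
  simp [ramificationSeries]

theorem coeff_pnat_ramificationSeries (s : ℕ+ → ℂ) (q : ℕ+) :
    PowerSeries.coeff (q : ℕ) (ramificationSeries s) = s q := by
  rw [ramificationSeries, PowerSeries.coeff_mk, dif_pos q.pos]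
  rfl

theorem laurentMatrix_ramification (s : ℕ+ → ℂ) (j : ℤ) (q : ℕ) :
    laurentMatrix (ramificationSymbol s) (j + q) j
      = HahnSeries.single (-1) (PowerSeries.coeff q (ramificationSeries s) / q) := by
  rw [laurentMatrix, entry, if_pos (by omega)]
  have h1 : (j + (q : ℤ) - j + (0 : ℕ)).toNat = q := by omega
  have h2 : ∀ x, symbolValue (ramificationSymbol s q) x
      = PowerSeries.C (PowerSeries.coeff q (ramificationSeries s) / q) := by
    intro x
    ext k
    rw [coeff_symbolValue, ramificationSymbol, PowerSeries.coeff_C]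
    split_ifs <;> simp
  rw [h1, h2, HahnSeries.ofPowerSeries_C, HahnSeries.C_apply, hbarInv, HahnSeries.single_mul_single,
    one_mul, add_zero]

theorem laurentMatrix_ramification_of_le (s : ℕ+ → ℂ) {k l : ℤ} (h : k ≤ l) :
    laurentMatrix (ramificationSymbol s) k l = 0 := by
  rcases lt_or_eq_of_le h with h' | rfl
  · exact triangular_laurentMatrix _ _ _ h'
  · have := laurentMatrix_ramification s k 0
    simpa [coeff_zero_ramificationSeries] using this

theorem ramification_eq_ofMatrix (s : ℕ+ → ℂ) :
    ramification s = ofMatrix (laurentMatrix (ramificationSymbol s)) := by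
  funext f T
  obtain ⟨N, hT⟩ := exists_inBox T
  rw [ofMatrix_apply (triangular_laurentMatrix _) f hT, ramification]
  have h1 : ∀ q : ℕ+, HahnSeries.single (-1) (s q / (q : ℂ)) * J (-(q : ℤ)) f T
      = ∑ p ∈ box N, if p.1 = p.2 + (q : ℕ) then
        HahnSeries.single (-1) (s q / (q : ℂ)) * E p.1 p.2 f T else 0 := by
    intro q
    rw [J, ofMatrix_apply (fun k l h => if_neg (by have := q.pos; omega)) f hT, Finset.mul_sum]
    refine Finset.sum_congr rfl fun p _ => ?_
    rw [sub_neg_eq_add, ite_mul, one_mul, zero_mul, mul_ite, mul_zero]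
  simp only [h1]
  rw [finsum_sum_comm]
  · refine Finset.sum_congr rfl fun p _ => ?_
    obtain ⟨i, j⟩ := p
    by_cases h : j < i
    · obtain ⟨q, hq⟩ := Int.eq_ofNat_of_zero_le (show 0 ≤ i - j by omega)
      obtain rfl : i = j + q := by omega
      have hq0 : 0 < q := by omega
      rw [finsum_eq_single _ ⟨q, hq0⟩, laurentMatrix_ramification]
      · simp only [PNat.mk_coe, if_true]
        rw [← coeff_pnat_ramificationSeries s ⟨q, hq0⟩]
        rfl
      · intro q' hne
        refine if_neg fun h' => hne (PNat.eq ?_)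
        simp only [PNat.mk_coe]
        omega
    · rw [laurentMatrix_ramification_of_le s (not_lt.1 h), zero_mul]
      refine finsum_eq_zero_of_forall_eq_zero fun q => if_neg ?_
      have := q.pos
      simp only
      omega
  · intro p _
    refine Set.Subsingleton.finite fun q hq q' hq' => ?_
    have e1 : p.1 = p.2 + (q : ℕ) := by
      by_contra h; exact hq (if_neg h)
    have e2 : p.1 = p.2 + (q' : ℕ) := by
      by_contra h; exact hq' (if_neg h)
    exact PNat.eq (by omega)

/-! ## Convergence -/

theorem HasExp.expApply {A : Fock → Fock} {f g : Fock} (h : HasExp A f g) :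
    HasExp A f (expApply A f) := by
  rw [LeakyHurwitz.expApply, dif_pos ⟨g, h⟩]
  exact Exists.choose_spec (⟨g, h⟩ : ∃ g, HasExp A f g)

open Classical in
/-- The energy of a diagram, up to a constant. -/
def energy (N : ℕ) (T : Maya) : ℕ :=
  ∑ n ∈ (Finset.Ico (-N : ℤ) N).filter (· ∈ T.carrier), (n + N).toNat

theorem energy_le (N : ℕ) (T : Maya) : energy N T ≤ ∑ n ∈ Finset.Ico (-N : ℤ) N, (n + N).toNat := by
  classical exact Finset.sum_le_sum_of_subset (Finset.filter_subset _ _)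

theorem energy_move_lt {N : ℕ} {T : Maya} (hT : InBox N T) {k l : ℤ} (hlk : l < k)
    (hk : k ∈ T.carrier) (hl : l ∉ T.carrier) :
    energy N ((T.erase k).insert l) < energy N T := by
  classical
  have h1 : -(N : ℤ) ≤ l := by
    by_contra h; exact hl (hT.1 l (by omega))
  have h2 : k < N := by
    by_contra h; exact hT.2 k (by omega) hk
  have h3 : (Finset.Ico (-N : ℤ) N).filter (· ∈ ((T.erase k).insert l).carrier)
      = Insert.insert l (((Finset.Ico (-N : ℤ) N).filter (· ∈ T.carrier)).erase k) := by
    ext n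
    simp only [Finset.mem_filter, Finset.mem_Ico, Maya.mem_insert, Maya.mem_erase,
      Finset.mem_insert, Finset.mem_erase]
    constructor
    · rintro ⟨hn, rfl | h⟩
      exacts [Or.inl rfl, Or.inr ⟨h.2, hn, h.1⟩]
    · rintro (rfl | ⟨h, hn, h'⟩)
      exacts [⟨⟨h1, by omega⟩, Or.inl rfl⟩, ⟨hn, Or.inr ⟨h', h⟩⟩]
  have h4 : k ∈ (Finset.Ico (-N : ℤ) N).filter (· ∈ T.carrier) := by
    rw [Finset.mem_filter, Finset.mem_Ico]
    exact ⟨⟨by omega, h2⟩, hk⟩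
  have h5 : l ∉ ((Finset.Ico (-N : ℤ) N).filter (· ∈ T.carrier)).erase k := by
    simp [hl]
  have h6 := Finset.add_sum_erase _ (fun n : ℤ => (n + N).toNat) h4
  have e1 : energy N ((T.erase k).insert l) = (l + N).toNat
      + ∑ n ∈ ((Finset.Ico (-N : ℤ) N).filter (· ∈ T.carrier)).erase k, (n + N).toNat := by
    rw [← Finset.sum_insert (f := fun n : ℤ => (n + N).toNat) h5, ← h3, energy]
  have e2 : energy N T
      = ∑ n ∈ (Finset.Ico (-N : ℤ) N).filter (· ∈ T.carrier), (n + N).toNat := by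
    rw [energy]
  omega

theorem iterate_ofMatrix_eq_zero {a : ℤ → ℤ → LaurentSeries ℂ} (ha : ∀ k l, k ≤ l → a k l = 0)
    (f : Fock) {N : ℕ} (M : ℕ) {T : Maya} (hT : InBox N T) (hM : energy N T < M) :
    (ofMatrix a)^[M] f T = 0 := by
  classical
  induction M generalizing T with
  | zero => omega
  | succ M ih =>
    rw [Function.iterate_succ_apply', ofMatrix_apply (fun k l h => ha k l h.le) _ hT]
    refine Finset.sum_eq_zero fun p _ => ?_
    rcases le_or_gt p.1 p.2 with h | h
    · rw [ha _ _ h, zero_mul]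
    · rw [E_apply_of_ne _ h.ne']
      split_ifs with hkl
      · rw [ih (hT.move h.le hkl.1 hkl.2)
          ((energy_move_lt hT h hkl.1 hkl.2).trans_le (Nat.lt_succ_iff.1 hM)), smul_zero, mul_zero]
      · rw [mul_zero]

/-- A number of steps after which the secondary ramification operator vanishes on a box. -/
def nilpotencyBound (N : ℕ) : ℕ := ∑ n ∈ Finset.Ico (-N : ℤ) N, (n + N).toNat + 1

theorem iterate_ramification_eq_zero (s : ℕ+ → ℂ) (f : Fock) {N M : ℕ} {T : Maya}
    (hT : InBox N T) (hM : nilpotencyBound N ≤ M) : (ramification s)^[M] f T = 0 := by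
  rw [ramification_eq_ofMatrix]
  refine iterate_ofMatrix_eq_zero (fun k l h => laurentMatrix_ramification_of_le s h) f M hT ?_
  have := energy_le N T
  rw [nilpotencyBound] at hM
  omega

/-- The partial sums of `e^A f`. -/
def partialExp (A : Fock → Fock) (f : Fock) (L : ℕ) (T : Maya) : LaurentSeries ℂ :=
  ∑ M ∈ Finset.range L, HahnSeries.single 0 (M ! : ℂ)⁻¹ * A^[M] f T

theorem hasSum_partialExp {A : Fock → Fock} {f : Fock} {L : ℕ} {T : Maya}
    (h : ∀ M, L ≤ M → A^[M] f T = 0) (n : ℤ) :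
    HasSum (fun M : ℕ => ((A^[M] f) T).coeff n / (M ! : ℂ)) ((partialExp A f L T).coeff n) := by
  have h1 : (partialExp A f L T).coeff n
      = ∑ M ∈ Finset.range L, ((A^[M] f) T).coeff n / (M ! : ℂ) := by
    rw [partialExp, HahnSeries.coeff_sum]
    refine Finset.sum_congr rfl fun M _ => ?_
    rw [HahnSeries.coeff_single_zero_mul, div_eq_inv_mul]
  rw [h1]
  refine hasSum_sum_of_ne_finset_zero fun M hM => ?_
  rw [h M (by simpa using hM)]
  simp

theorem hasExp_ramification (s : ℕ+ → ℂ) :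
    HasExp (ramification s) vacuum (ramificationVector s) := by
  have h : HasExp (ramification s) vacuum fun T =>
      partialExp (ramification s) vacuum (nilpotencyBound (exists_inBox T).choose) T :=
    fun T n => hasSum_partialExp
      (fun M hM => iterate_ramification_eq_zero s _ (exists_inBox T).choose_spec hM) n
  exact h.expApply

theorem ramificationVector_apply (s : ℕ+ → ℂ) {N L : ℕ} {T : Maya} (hT : InBox N T)
    (hL : nilpotencyBound N ≤ L) :
    ramificationVector s T = partialExp (ramification s) vacuum L T := by
  ext n
  exact (hasExp_ramification s T n).unique
    (hasSum_partialExp (fun M hM => iterate_ramification_eq_zero s _ hT (hL.trans hM)) n)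

theorem coeff_ofPowerSeries_mul (y : ℂ⟦X⟧) {x : LaurentSeries ℂ} {D : ℤ}
    (hx : ∀ b, b < D → x.coeff b = 0) (k : ℤ) :
    (HahnSeries.ofPowerSeries ℤ ℂ y * x).coeff k
      = ∑ b ∈ Finset.Icc D k, PowerSeries.coeff (k - b).toNat y * x.coeff b := by
  have hy : ∀ a : ℤ, (HahnSeries.ofPowerSeries ℤ ℂ y).coeff a
      = if a < 0 then 0 else PowerSeries.coeff a.toNat y := by
    intro a
    rw [PowerSeries.coeff_coe]
    split_ifs with h
    · rfl
    · congr 2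
      omega
  rw [HahnSeries.coeff_mul]
  refine Finset.sum_of_injOn (fun p => p.2) ?_ ?_ ?_ ?_
  · rintro ⟨a, b⟩ h ⟨a', b'⟩ h' hbb
    simp only [Finset.mem_coe, Finset.mem_antidiagonal] at h h' hbb
    rw [Prod.mk.injEq]
    omega
  · rintro ⟨a, b⟩ h
    simp only [Finset.mem_coe, Finset.mem_antidiagonal, HahnSeries.mem_support] at h
    have ha : 0 ≤ a := by
      by_contra hcon
      exact h.1 (by rw [hy, if_pos (not_le.1 hcon)])
    have hb : D ≤ b := by
      by_contra hcon
      exact h.2.1 (hx b (not_le.1 hcon))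
    simp only [Finset.mem_coe, Finset.mem_Icc]
    omega
  · intro b hb hnot
    rw [Finset.mem_Icc] at hb
    by_contra hne
    apply hnot
    refine ⟨(k - b, b), ?_, rfl⟩
    simp only [Finset.mem_coe, Finset.mem_antidiagonal, HahnSeries.mem_support]
    refine ⟨?_, right_ne_zero_of_mul hne, by omega⟩
    rw [hy, if_neg (by omega)]
    exact left_ne_zero_of_mul hne
  · rintro ⟨a, b⟩ h
    simp only [Finset.mem_antidiagonal, HahnSeries.mem_support] at h
    have ha : ¬ a < 0 := fun hcon => h.1 (by rw [hy, if_pos hcon])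
    rw [hy, if_neg ha]
    have : k - b = a := by omega
    rw [this]

/-- On a box, triangular operators with entries in `ℂ⟦ħ⟧` are finite matrices over `ℂ⟦ħ⟧`. -/
theorem exists_ofMatrix_eq_sum {a : ℤ → ℤ → LaurentSeries ℂ} (ha : Triangular a)
    {b : ℤ → ℤ → ℂ⟦X⟧} (hb : ∀ k l, a k l = HahnSeries.ofPowerSeries ℤ ℂ (b k l)) {N : ℕ}
    {T : Maya} (hT : InBox N T) : ∃ ω : Maya → ℂ⟦X⟧, ∀ f : Fock, ofMatrix a f T
      = ∑ T' ∈ (finite_inBox N).toFinset, HahnSeries.ofPowerSeries ℤ ℂ (ω T') * f T' := by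
  classical
  have h1 : ∀ p : ℤ × ℤ, ∃ ω : Maya → ℂ⟦X⟧, ∀ f : Fock, a p.1 p.2 * E p.1 p.2 f T
      = ∑ T' ∈ (finite_inBox N).toFinset, HahnSeries.ofPowerSeries ℤ ℂ (ω T') * f T' := by
    have hsingle : ∀ T₀, InBox N T₀ → ∀ y : ℂ⟦X⟧, ∀ f : Fock,
        ∑ T' ∈ (finite_inBox N).toFinset,
          HahnSeries.ofPowerSeries ℤ ℂ ((Pi.single T₀ y : Maya → ℂ⟦X⟧) T') * f T'
        = HahnSeries.ofPowerSeries ℤ ℂ y * f T₀ := by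
      intro T₀ hT₀ y f
      rw [Finset.sum_eq_single T₀]
      · rw [Pi.single_eq_same]
      · intro T' _ hne
        rw [Pi.single_eq_of_ne hne, map_zero, zero_mul]
      · intro h
        exact absurd ((finite_inBox N).mem_toFinset.2 hT₀) h
    rintro ⟨k, l⟩
    simp only
    rcases lt_trichotomy k l with h | rfl | h
    · refine ⟨0, fun f => ?_⟩
      simp [ha k l h]
    · obtain ⟨c, hc⟩ : ∃ c : ℤ, ∀ f : Fock, E k k f T = c • f T := by
        refine ⟨(if k ∈ T.carrier then 1 else 0) - (if k < 0 then 1 else 0), fun f => ?_⟩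
        rw [E_self_apply, sub_smul, ite_smul, ite_smul, one_smul, zero_smul]
      refine ⟨Pi.single T (c • b k k), fun f => ?_⟩
      rw [hsingle T hT, hc, hb, map_zsmul, smul_mul_assoc, mul_smul_comm]
    · by_cases hkl : k ∈ T.carrier ∧ l ∉ T.carrier
      · refine ⟨Pi.single ((T.erase k).insert l)
          ((T.sign k * (T.erase k).sign l) • b k l), fun f => ?_⟩
        rw [hsingle _ (hT.move h.le hkl.1 hkl.2), E_apply_of_ne f h.ne', if_pos hkl, hb, map_zsmul,
          smul_mul_assoc, mul_smul_comm]
      · refine ⟨0, fun f => ?_⟩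
        rw [E_apply_of_ne f h.ne', if_neg hkl]
        simp
  choose ω hω using h1
  refine ⟨fun T' => ∑ p ∈ box N, ω p T', fun f => ?_⟩
  rw [ofMatrix_apply ha f hT]
  simp only [hω, map_sum, Finset.sum_mul]
  exact Finset.sum_comm

/-- Triangular operators with entries in `ℂ⟦ħ⟧` can be exponentiated. -/
theorem exists_hasExp_ofMatrix {a : ℤ → ℤ → LaurentSeries ℂ} (ha : Triangular a)
    {b : ℤ → ℤ → ℂ⟦X⟧} (hb : ∀ k l, a k l = HahnSeries.ofPowerSeries ℤ ℂ (b k l)) (f : Fock) :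
    ∃ g, HasExp (ofMatrix a) f g := by
  suffices h : ∀ T, ∃ x : LaurentSeries ℂ, ∀ n,
      HasSum (fun N : ℕ => (((ofMatrix a)^[N] f) T).coeff n / (N ! : ℂ)) (x.coeff n) by
    choose g hg using h
    exact ⟨g, fun T n => hg T n⟩
  intro T
  obtain ⟨K, hT⟩ := exists_inBox T
  set F := (finite_inBox K).toFinset with hF
  have hmem : ∀ T', T' ∈ F ↔ InBox K T' := fun T' => (finite_inBox K).mem_toFinset
  have h1 : ∀ T', ∃ ω : Maya → ℂ⟦X⟧, InBox K T' → ∀ f : Fock, ofMatrix a f T'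
      = ∑ T'' ∈ F, HahnSeries.ofPowerSeries ℤ ℂ (ω T'') * f T'' := by
    intro T'
    by_cases h : InBox K T'
    · obtain ⟨ω, hω⟩ := exists_ofMatrix_eq_sum ha hb h
      exact ⟨ω, fun _ => hω⟩
    · exact ⟨0, fun h' => absurd h' h⟩
  choose ω hω using h1
  obtain ⟨D, hD⟩ : ∃ D : ℤ, ∀ T' ∈ F, ∀ k < D, (f T').coeff k = 0 := by
    refine ⟨-∑ T' ∈ F, |(f T').order|, fun T' hT' k hk => ?_⟩
    have h2 := Finset.single_le_sum (f := fun T' => |(f T').order|) (fun _ _ => abs_nonneg _) hT'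
    have h3 := neg_abs_le (f T').order
    exact HahnSeries.coeff_eq_zero_of_lt_order (by omega)
  have hlow : ∀ N, ∀ T' ∈ F, ∀ k < D, (((ofMatrix a)^[N] f) T').coeff k = 0 := by
    intro N
    induction N with
    | zero => exact hD
    | succ N ih =>
      intro T' hT' k hk
      rw [Function.iterate_succ_apply', hω T' ((hmem T').1 hT'), HahnSeries.coeff_sum]
      refine Finset.sum_eq_zero fun T'' hT'' => ?_
      rw [coeff_ofPowerSeries_mul _ (ih T'' hT''), Finset.Icc_eq_empty (by omega), Finset.sum_empty]
  have hsum : ∀ n, Summable fun N : ℕ => (((ofMatrix a)^[N] f) T).coeff n / (N ! : ℂ) := by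
    intro n
    rcases lt_or_ge n D with hn | hn
    · have : (fun N : ℕ => (((ofMatrix a)^[N] f) T).coeff n / (N ! : ℂ)) = fun _ => 0 := by
        funext N
        rw [hlow N T ((hmem T).2 hT) n hn, zero_div]
      rw [this]
      exact summable_zero
    refine summable_of_linear_recurrence (F ×ˢ Finset.Icc D n)
      (fun N x => (((ofMatrix a)^[N] f) x.1).coeff x.2)
      (fun x y => if y.2 ≤ x.2 then PowerSeries.coeff (x.2 - y.2).toNat (ω x.1 y.1) else 0) ?_
      (e := (T, n)) (Finset.mem_product.2 ⟨(hmem T).2 hT, Finset.mem_Icc.2 ⟨hn, le_rfl⟩⟩)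
    rintro N ⟨T', k⟩ hTk
    rw [Finset.mem_product, Finset.mem_Icc] at hTk
    simp only at hTk ⊢
    rw [Function.iterate_succ_apply', hω T' ((hmem T').1 hTk.1), HahnSeries.coeff_sum,
      Finset.sum_product]
    refine Finset.sum_congr rfl fun T'' hT'' => ?_
    rw [coeff_ofPowerSeries_mul _ (hlow N T'' hT'')]
    refine Finset.sum_subset_zero_on_sdiff (Finset.Icc_subset_Icc_right hTk.2.2) ?_ ?_
    · intro c hc
      rw [Finset.mem_sdiff, Finset.mem_Icc, Finset.mem_Icc] at hc
      rw [if_neg (by omega), zero_mul]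
    · intro c hc
      rw [if_pos (Finset.mem_Icc.1 hc).2]
  refine ⟨HahnSeries.ofSuppBddBelow
    (fun n => ∑' N : ℕ, (((ofMatrix a)^[N] f) T).coeff n / (N ! : ℂ)) ⟨D, fun n hn => ?_⟩,
    fun n => (hsum n).hasSum⟩
  by_contra hlt
  apply hn
  simp only
  have : (fun N : ℕ => (((ofMatrix a)^[N] f) T).coeff n / (N ! : ℂ)) = fun _ => 0 := by
    funext N
    rw [hlow N T ((hmem T).2 hT) n (not_le.1 hlt), zero_div]
  rw [this, tsum_zero]

theorem hasExp_W {w : ℕ → PowerSeries (LaurentSeries ℂ)}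
    (hh : ∀ n, cf (dequantisation w) n 0 = 0) (f : Fock) : HasExp (W w) f (expApply (W w) f) := by
  have hX : ∀ k l, (PowerSeries.X : ℂ⟦X⟧) ∣ entry 0 (cutJoinSymbol w) k l := by
    intro k l
    rw [entry]
    split_ifs
    · rw [PowerSeries.X_dvd_iff, ← PowerSeries.coeff_zero_eq_constantCoeff_apply,
        coeff_symbolValue, Polynomial.eq_C_of_natDegree_le_zero (isSymbol_cutJoin w _ 0).1,
        (isSymbol_cutJoin w _ 0).2, hh, Polynomial.eval_C]
    · exact dvd_zero _
  choose b hb using hX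
  have h1 : ∀ k l, laurentMatrix (cutJoinSymbol w) k l = HahnSeries.ofPowerSeries ℤ ℂ (b k l) := by
    intro k l
    rw [laurentMatrix, hb, map_mul, HahnSeries.ofPowerSeries_X, ← mul_assoc, hbarInv,
      HahnSeries.single_mul_single, mul_one, neg_add_cancel]
    change (1 : LaurentSeries ℂ) * _ = _
    rw [one_mul]
  obtain ⟨g, hg⟩ := exists_hasExp_ofMatrix (triangular_laurentMatrix _) h1 f
  rw [← W_eq_ofMatrix] at hg
  exact hg.expApply

/-! ## The one-point function -/

/-- The vacuum expectation of the quantisation of `z^{-m} α` applied to `f`. -/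
def tracePairing (m : ℕ) (α : ℕ → ℕ → Polynomial ℂ) (f : Fock) : LaurentSeries ℂ :=
  ∑ i ∈ Finset.Ico (-m : ℤ) 0, ∑ j ∈ Finset.Ico 0 (m : ℤ),
    HahnSeries.ofPowerSeries ℤ ℂ (entry m α i j) * hookCoeff f i j

/-- The cocycle of the quantisations of `z^{-m} α` and `ħ⁻¹ u`. -/
def cocycle (m : ℕ) (α u : ℕ → ℕ → Polynomial ℂ) : LaurentSeries ℂ :=
  ∑ i ∈ Finset.Ico (-m : ℤ) 0, ∑ j ∈ Finset.Ico 0 (m : ℤ),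
    HahnSeries.ofPowerSeries ℤ ℂ (entry m α i j) * laurentMatrix u j i

theorem hbarInv_mul_X : hbarInv * HahnSeries.ofPowerSeries ℤ ℂ PowerSeries.X = 1 := by
  rw [HahnSeries.ofPowerSeries_X, hbarInv, HahnSeries.single_mul_single, mul_one, neg_add_cancel]
  rfl

theorem laurentMatrix_commutator {u α : ℕ → ℕ → Polynomial ℂ} {h F : MvPowerSeries (Fin 2) ℂ}
    (hα : IsSymbol α F) (hu : IsSymbol u h) (m : ℕ) {i l : ℤ} (hi : i < 0) (hl : 0 ≤ l) :
    ∑ j ∈ Finset.Ico 0 (m : ℤ), HahnSeries.ofPowerSeries ℤ ℂ (entry m α i j) * laurentMatrix u j l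
      - ∑ j ∈ Finset.Ico (-m : ℤ) 0,
        laurentMatrix u i j * HahnSeries.ofPowerSeries ℤ ℂ (entry m α j l)
      = HahnSeries.ofPowerSeries ℤ ℂ (entry m (moyalBracket m u α) i l) := by
  have h1 := congrArg (HahnSeries.ofPowerSeries ℤ ℂ) (entry_commutator hα hu m hi hl)
  simp only [map_sub, map_sum, map_mul] at h1
  have h2 := congrArg (hbarInv * ·) h1
  beta_reduce at h2
  rw [← mul_assoc, hbarInv_mul_X, one_mul] at h2
  rw [← h2, mul_sub, Finset.mul_sum, Finset.mul_sum]
  simp only [laurentMatrix]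
  congr 1
  · exact Finset.sum_congr rfl fun j _ => mul_left_comm _ _ _
  · exact Finset.sum_congr rfl fun j _ => mul_assoc _ _ _

theorem sum_mul_commutator {R ι : Type*} [CommRing R] (I J : Finset ι) {A B w κ κ' : ι → ι → R}
    {v : R} (hκ : ∀ i ∈ I, ∀ j ∈ J, κ' i j
      = w j i * v + ∑ l ∈ J, w j l * κ i l - ∑ k ∈ I, w k i * κ k j)
    (hB : ∀ i ∈ I, ∀ l ∈ J, ∑ j ∈ J, A i j * w j l - ∑ k ∈ I, w i k * A k l = B i l) :
    ∑ i ∈ I, ∑ j ∈ J, A i j * κ' i j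
      = (∑ i ∈ I, ∑ j ∈ J, A i j * w j i) * v + ∑ i ∈ I, ∑ j ∈ J, B i j * κ i j := by
  have h1 : ∑ i ∈ I, ∑ j ∈ J, A i j * κ' i j = ∑ i ∈ I, ∑ j ∈ J, A i j * w j i * v
      + ∑ i ∈ I, ∑ j ∈ J, ∑ l ∈ J, A i j * w j l * κ i l
      - ∑ i ∈ I, ∑ j ∈ J, ∑ k ∈ I, w k i * A i j * κ k j := by
    rw [← Finset.sum_add_distrib, ← Finset.sum_sub_distrib]
    refine Finset.sum_congr rfl fun i hi => ?_
    rw [← Finset.sum_add_distrib, ← Finset.sum_sub_distrib]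
    refine Finset.sum_congr rfl fun j hj => ?_
    rw [hκ i hi j hj, mul_sub, mul_add, Finset.mul_sum, Finset.mul_sum, ← mul_assoc]
    simp only [← mul_assoc, mul_comm (A i j) (w _ i)]
  have h2 : ∑ i ∈ I, ∑ j ∈ J, B i j * κ i j
      = ∑ i ∈ I, ∑ l ∈ J, ∑ j ∈ J, A i j * w j l * κ i l
        - ∑ k ∈ I, ∑ j ∈ J, ∑ i ∈ I, w k i * A i j * κ k j := by
    rw [← Finset.sum_sub_distrib]
    refine Finset.sum_congr rfl fun i hi => ?_
    rw [← Finset.sum_sub_distrib]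
    refine Finset.sum_congr rfl fun j hj => ?_
    rw [← hB i hi j hj, sub_mul, Finset.sum_mul, Finset.sum_mul]
  have h3 : ∑ i ∈ I, ∑ j ∈ J, ∑ k ∈ I, w k i * A i j * κ k j
      = ∑ k ∈ I, ∑ j ∈ J, ∑ i ∈ I, w k i * A i j * κ k j := by
    rw [Finset.sum_congr rfl fun i _ => Finset.sum_comm, Finset.sum_comm]
    exact Finset.sum_congr rfl fun k _ => Finset.sum_comm
  rw [h1, h2, h3, Finset.sum_congr rfl fun i _ => Finset.sum_comm, Finset.sum_mul, add_sub_assoc]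
  simp only [Finset.sum_mul]

theorem tracePairing_ofMatrix {u α : ℕ → ℕ → Polynomial ℂ} {h F : MvPowerSeries (Fin 2) ℂ}
    (hα : IsSymbol α F) (hu : IsSymbol u h) (m : ℕ) (f : Fock) :
    tracePairing m α (ofMatrix (laurentMatrix u) f)
      = cocycle m α u * f Maya.vac + tracePairing m (moyalBracket m u α) f :=
  sum_mul_commutator _ _
    (fun _ hi _ hj => hookCoeff_ofMatrix (triangular_laurentMatrix u) f hi hj)
    (fun _ hi _ hl =>
      laurentMatrix_commutator hα hu m (Finset.mem_Ico.1 hi).2 (Finset.mem_Ico.1 hl).1)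

theorem coeff_cocycle {u α : ℕ → ℕ → Polynomial ℂ} {h F : MvPowerSeries (Fin 2) ℂ}
    (hα : IsSymbol α F) (hu : IsSymbol u h) (m : ℕ) :
    (cocycle m α u).coeff (-1) = PowerSeries.coeff m (slice 0 F * euler (slice 0 h)) := by
  rw [← sum_coeff_zero_entry hα hu m, cocycle, HahnSeries.coeff_sum]
  refine Finset.sum_congr rfl fun i _ => ?_
  rw [HahnSeries.coeff_sum]
  refine Finset.sum_congr rfl fun j _ => ?_
  rw [laurentMatrix, mul_left_comm, ← map_mul, coeff_neg_one_hbarInv_mul]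
  simp

theorem IsSymbol.iterate {u α : ℕ → ℕ → Polynomial ℂ} {h F : MvPowerSeries (Fin 2) ℂ}
    (hα : IsSymbol α F) (hu : IsSymbol u h) (m N : ℕ) :
    IsSymbol ((LeakyHurwitz.moyalBracket m u)^[N] α) ((twistedField h m)^[N] F) := by
  induction N with
  | zero => exact hα
  | succ N ih =>
    rw [Function.iterate_succ_apply', Function.iterate_succ_apply']
    exact ih.moyalBracket hu m

theorem pairing_iterate_succ {V S R : Type*} [AddCommGroup R] {A : V → V} {b : S → S}
    {τ : S → V → R} {c : S → R} {P : S → Prop} {f : V} (hP : ∀ α, P α → P (b α))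
    (h0 : ∀ α, P α → τ α (A f) = c α + τ (b α) f)
    (h1 : ∀ α, P α → ∀ g, τ α (A (A g)) = τ (b α) (A g)) (N : ℕ) {α : S} (hα : P α) :
    τ α (A^[N + 1] f) = c (b^[N] α) + τ (b^[N + 1] α) f := by
  induction N generalizing α with
  | zero => exact h0 α hα
  | succ N ih =>
    rw [Function.iterate_succ_apply', Function.iterate_succ_apply', h1 α hα,
      ← Function.iterate_succ_apply' A, ih (hP α hα)]
    rfl

theorem coeff_tracePairing_iterate_succ {u α : ℕ → ℕ → Polynomial ℂ}
    {h F : MvPowerSeries (Fin 2) ℂ} (hα : IsSymbol α F) (hu : IsSymbol u h) (m N : ℕ) {f : Fock}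
    (hf : f Maya.vac = 1) :
    (tracePairing m α ((ofMatrix (laurentMatrix u))^[N + 1] f)).coeff (-1)
      = PowerSeries.coeff m (slice 0 ((twistedField h m)^[N] F) * euler (slice 0 h))
        + (tracePairing m ((moyalBracket m u)^[N + 1] α) f).coeff (-1) := by
  have h1 := pairing_iterate_succ (A := ofMatrix (laurentMatrix u)) (b := moyalBracket m u)
    (τ := tracePairing m) (c := fun α => cocycle m α u) (P := fun α => ∃ F, IsSymbol α F) (f := f)
    (fun α ⟨F, hF⟩ => ⟨_, hF.moyalBracket hu m⟩)
    (fun α ⟨F, hF⟩ => by rw [tracePairing_ofMatrix hF hu, hf, mul_one])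
    (fun α ⟨F, hF⟩ g => by
      rw [tracePairing_ofMatrix hF hu, ofMatrix_vac (triangular_laurentMatrix u), mul_zero,
        zero_add])
    N ⟨F, hα⟩
  rw [h1, HahnSeries.coeff_add, coeff_cocycle (hα.iterate hu m N) hu]

theorem tracePairing_vacuum (m : ℕ) (α : ℕ → ℕ → Polynomial ℂ) : tracePairing m α vacuum = 0 := by
  refine Finset.sum_eq_zero fun i hi => Finset.sum_eq_zero fun j hj => ?_
  rw [hookCoeff_vacuum (Finset.mem_Ico.1 hi).2 (Finset.mem_Ico.1 hj).1, mul_zero]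

theorem euler_slice_ramificationHamiltonian (s : ℕ+ → ℂ) :
    euler (slice 0 (ramificationHamiltonian s)) = ramificationSeries s := by
  ext n
  rw [coeff_euler, coeff_slice, cf_ramificationHamiltonian, if_pos rfl]
  rcases eq_or_ne n 0 with rfl | hn
  · rw [coeff_zero_ramificationSeries]; simp
  · rw [mul_div_cancel₀ _ (by exact_mod_cast hn)]

theorem slice_mul_of_slice_eq_zero {f g : MvPowerSeries (Fin 2) ℂ}
    (hf : ∀ n k, k ≠ 0 → cf f n k = 0) (k : ℕ) : slice k (f * g) = slice 0 f * slice k g := by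
  ext n
  rw [coeff_slice, cf_mul, PowerSeries.coeff_mul]
  refine Finset.sum_congr rfl fun p _ => ?_
  rw [Finset.sum_eq_single (0, k)]
  · rw [coeff_slice, coeff_slice]
  · rintro ⟨a, b⟩ hab hne
    rw [mem_antidiagonal] at hab
    rw [hf _ a (by rintro rfl; exact hne (by simpa using hab)), zero_mul]
  · intro hk
    exact absurd (by rw [mem_antidiagonal]; simp) hk

theorem slice_twistedField_ramification (s : ℕ+ → ℂ) (c : ℂ) (F : MvPowerSeries (Fin 2) ℂ)
    (k : ℕ) : slice k (twistedField (ramificationHamiltonian s) c F)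
      = PowerSeries.C ((k : ℂ) + 1) * (ramificationSeries s * slice (k + 1) F) := by
  have h1 : ds (ramificationHamiltonian s) = 0 := by
    refine cf_ext fun n k => ?_
    rw [cf_ds, cf_ramificationHamiltonian, if_neg k.succ_ne_zero, mul_zero]
    exact (map_zero _).symm
  rw [twistedField_apply, hamiltonianField, h1, zero_mul, zero_mul, smul_zero, add_zero, sub_zero,
    slice_mul_of_slice_eq_zero, ← euler_slice, euler_slice_ramificationHamiltonian, slice_ds]
  · have : (k : ℂ⟦X⟧) + 1 = PowerSeries.C ((k : ℂ) + 1) := by simp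
    rw [this]; ring
  · intro n k hk
    rw [cf_zdz, cf_ramificationHamiltonian, if_neg hk, mul_zero]

theorem slice_iterate_twistedField_ramification (s : ℕ+ → ℂ) (c : ℂ)
    (F : MvPowerSeries (Fin 2) ℂ) (M k : ℕ) :
    PowerSeries.C (k ! : ℂ) * slice k ((twistedField (ramificationHamiltonian s) c)^[M] F)
      = PowerSeries.C ((k + M)! : ℂ) * (ramificationSeries s ^ M * slice (k + M) F) := by
  induction M generalizing k with
  | zero => simp
  | succ M ih =>
    rw [Function.iterate_succ_apply', slice_twistedField_ramification]
    have h1 := ih (k + 1)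
    have h2 : PowerSeries.C ((k + 1)! : ℂ) = PowerSeries.C (k ! : ℂ) * PowerSeries.C ((k : ℂ) + 1) := by
      rw [← map_mul, Nat.factorial_succ]; push_cast; rw [mul_comm]
    rw [h2] at h1
    have h3 : k + (M + 1) = k + 1 + M := by ring
    rw [h3]
    linear_combination ramificationSeries s * h1

theorem coeff_tracePairing_iterate_ramification (s : ℕ+ → ℂ) {α : ℕ → ℕ → Polynomial ℂ}
    {F : MvPowerSeries (Fin 2) ℂ} (hα : IsSymbol α F) (m M : ℕ) :
    (tracePairing m α ((ramification s)^[M + 1] vacuum)).coeff (-1)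
      = (M ! : ℂ) * PowerSeries.coeff m (ramificationSeries s ^ (M + 1) * slice M F) := by
  have h1 := slice_iterate_twistedField_ramification s m F M 0
  rw [Nat.factorial_zero, Nat.cast_one, map_one, one_mul, zero_add] at h1
  rw [ramification_eq_ofMatrix, coeff_tracePairing_iterate_succ hα (isSymbol_ramification s) m M
    vacuum_vac, tracePairing_vacuum, HahnSeries.coeff_zero, add_zero, h1,
    euler_slice_ramificationHamiltonian, mul_assoc, PowerSeries.coeff_C_mul, pow_succ]
  congr 2
  ring

theorem ramificationVector_vac (s : ℕ+ → ℂ) : ramificationVector s Maya.vac = 1 := by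
  rw [ramificationVector_apply s (inBox_vac 0) le_rfl, partialExp, Finset.sum_eq_single 0]
  · simp [vacuum_vac]
  · intro M _ hM
    obtain ⟨M, rfl⟩ := Nat.exists_eq_succ_of_ne_zero hM
    rw [Function.iterate_succ_apply', ramification_eq_ofMatrix,
      ofMatrix_vac (triangular_laurentMatrix _), mul_zero]
  · intro h
    simp [nilpotencyBound] at h

theorem coeff_tracePairing_ramificationVector (s : ℕ+ → ℂ) {α : ℕ → ℕ → Polynomial ℂ}
    {F : MvPowerSeries (Fin 2) ℂ} (hα : IsSymbol α F) (m : ℕ) :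
    (tracePairing m α (ramificationVector s)).coeff (-1) = ∑ M ∈ Finset.range m,
      1 / ((M : ℂ) + 1) * PowerSeries.coeff m (ramificationSeries s ^ (M + 1) * slice M F) := by
  set L := m + nilpotencyBound m with hL
  have h1 : tracePairing m α (ramificationVector s) = ∑ M ∈ Finset.range (L + 1),
      HahnSeries.single 0 (M ! : ℂ)⁻¹ * tracePairing m α ((ramification s)^[M] vacuum) := by
    have h2 : ∀ i ∈ Finset.Ico (-m : ℤ) 0, ∀ j ∈ Finset.Ico 0 (m : ℤ),
        HahnSeries.ofPowerSeries ℤ ℂ (entry m α i j) * hookCoeff (ramificationVector s) i j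
          = ∑ M ∈ Finset.range (L + 1), HahnSeries.single 0 (M ! : ℂ)⁻¹
            * (HahnSeries.ofPowerSeries ℤ ℂ (entry m α i j)
              * hookCoeff ((ramification s)^[M] vacuum) i j) := by
      intro i hi j hj
      have hi' := (Finset.mem_Ico.1 hi).2
      have hj' := (Finset.mem_Ico.1 hj).1
      rw [hookCoeff_eq_smul _ hi' hj', ramificationVector_apply s (inBox_hook hi hj)
        (show nilpotencyBound m ≤ L + 1 by omega), partialExp, Finset.smul_sum, Finset.mul_sum]
      refine Finset.sum_congr rfl fun M _ => ?_
      rw [hookCoeff_eq_smul _ hi' hj', ← mul_smul_comm, mul_left_comm]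
    rw [tracePairing, Finset.sum_congr rfl fun i hi => Finset.sum_congr rfl (h2 i hi)]
    simp only [tracePairing, Finset.mul_sum]
    rw [Finset.sum_congr rfl fun i _ => Finset.sum_comm, Finset.sum_comm]
  rw [h1, HahnSeries.coeff_sum, Finset.sum_range_succ', Function.iterate_zero, id,
    tracePairing_vacuum, mul_zero, HahnSeries.coeff_zero, add_zero, eq_comm]
  have h3 : ∀ M : ℕ, 1 / ((M : ℂ) + 1)
        * PowerSeries.coeff m (ramificationSeries s ^ (M + 1) * slice M F)
      = (HahnSeries.single 0 ((M + 1)! : ℂ)⁻¹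
        * tracePairing m α ((ramification s)^[M + 1] vacuum)).coeff (-1) := by
    intro M
    have hM : (M ! : ℂ) ≠ 0 := by exact_mod_cast M.factorial_ne_zero
    rw [HahnSeries.coeff_single_zero_mul, coeff_tracePairing_iterate_ramification s hα,
      Nat.factorial_succ]
    push_cast
    rw [mul_inv, ← mul_assoc, mul_assoc _ _ (M ! : ℂ), inv_mul_cancel₀ hM, mul_one, one_div]
  simp only [h3]
  refine Finset.sum_subset (Finset.range_mono (by omega)) fun M _ hM => ?_
  rw [← h3, mul_comm (ramificationSeries s ^ _), coeff_mul_pow_eq_zero, mul_zero]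
  · rw [← PowerSeries.coeff_zero_eq_constantCoeff_apply, coeff_zero_ramificationSeries]
  · rw [Finset.mem_range] at hM
    omega

/-- The symbol of `1`. -/
def oneSymbol (n k : ℕ) : Polynomial ℂ := if n = 0 ∧ k = 0 then 1 else 0

theorem isSymbol_one : IsSymbol oneSymbol 1 := by
  intro n k
  rw [oneSymbol, cf_one]
  split_ifs with h
  · simp [h.2]
  · simp

theorem covacuum_J_eq_tracePairing {m : ℕ} (hm : m ≠ 0) (f : Fock) :
    covacuum (J m f) = tracePairing m oneSymbol f := by
  rw [covacuum_J m hm, tracePairing, Finset.sum_comm]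
  refine Finset.sum_congr rfl fun j hj => ?_
  rw [Finset.mem_Ico] at hj
  rw [Finset.sum_eq_single (j - m)]
  · have h1 : entry m oneSymbol (j - m) j = 1 := by
      rw [entry, if_pos (by omega)]
      have : (j - (m : ℤ) - j + m).toNat = 0 := by omega
      rw [this]
      ext k
      rw [coeff_symbolValue, oneSymbol, PowerSeries.coeff_one]
      by_cases hk : k = 0 <;> simp [hk]
    rw [h1, map_one, one_mul]
  · intro i _ hne
    have h1 : entry m oneSymbol i j = 0 := by
      rw [entry]
      split_ifs with h
      · ext k
        have h2 : (i - j + (m : ℤ)).toNat ≠ 0 := by omega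
        rw [coeff_symbolValue, oneSymbol, if_neg (fun h => h2 h.1)]
        simp
      · rfl
    rw [h1, map_zero, zero_mul]
  · intro h
    exact absurd (Finset.mem_Ico.2 ⟨by omega, by omega⟩) h

theorem HasExp.coeff_hookCoeff {A : Fock → Fock} {f g : Fock} (h : HasExp A f g) {i j : ℤ}
    (hi : i < 0) (hj : 0 ≤ j) (n : ℤ) :
    HasSum (fun N : ℕ => (hookCoeff (A^[N] f) i j).coeff n / (N ! : ℂ))
      ((hookCoeff g i j).coeff n) := by
  simp only [hookCoeff_eq_smul _ hi hj, HahnSeries.coeff_smul]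
  simpa [mul_div_assoc] using (h ((Maya.vac.erase i).insert j) n).mul_left
    (((Maya.vac.sign i * (Maya.vac.erase i).sign j : ℤ) : ℂ))

theorem HasExp.coeff_covacuum_J {A : Fock → Fock} {f g : Fock} (h : HasExp A f g) {m : ℕ}
    (hm : m ≠ 0) (n : ℤ) :
    HasSum (fun N : ℕ => (covacuum (J m (A^[N] f))).coeff n / (N ! : ℂ))
      ((covacuum (J m g)).coeff n) := by
  simp only [covacuum_J m hm, HahnSeries.coeff_sum, Finset.sum_div]
  refine hasSum_sum fun j hj => ?_
  rw [Finset.mem_Ico] at hj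
  exact h.coeff_hookCoeff (by omega) hj.1 n

theorem coeff_onePoint {w : ℕ → PowerSeries (LaurentSeries ℂ)}
    (hh : ∀ n, cf (dequantisation w) n 0 = 0) (s : ℕ+ → ℂ) {m : ℕ} (hm : m ≠ 0) :
    (onePoint w s m).coeff (-1) = ∑ M ∈ Finset.range m, 1 / ((M : ℂ) + 1) * PowerSeries.coeff m
      (ramificationSeries s ^ (M + 1) * slice M (twistedFlow (dequantisation w) m)) := by
  have h1 := (hasExp_W hh (ramificationVector s)).coeff_covacuum_J hm (-1)
  refine h1.unique ?_
  have h2 : ∀ N, (covacuum (J m ((W w)^[N] (ramificationVector s)))).coeff (-1)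
      = ∑ M ∈ Finset.range m, 1 / ((M : ℂ) + 1) * PowerSeries.coeff m
        (ramificationSeries s ^ (M + 1) * slice M ((twistedField (dequantisation w) m)^[N] 1)) := by
    intro N
    have hα := isSymbol_one.iterate (isSymbol_cutJoin w) m N
    rw [covacuum_J_eq_tracePairing hm, ← coeff_tracePairing_ramificationVector s hα]
    cases N with
    | zero => rfl
    | succ N =>
      have h0 : slice 0 (dequantisation w) = 0 := by ext n; simp [hh]
      rw [W_eq_ofMatrix, coeff_tracePairing_iterate_succ isSymbol_one (isSymbol_cutJoin w) m N
        (ramificationVector_vac s), h0]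
      simp [euler]
  simp only [h2, Finset.sum_div]
  refine hasSum_sum fun M _ => ?_
  simp only [mul_div_assoc]
  refine HasSum.mul_left _ ?_
  simp only [PowerSeries.coeff_mul, Finset.sum_div, mul_div_assoc, coeff_slice]
  refine hasSum_sum fun p _ => HasSum.mul_left _ ?_
  have h3 := coeffSum_expSum hh m 1 p.2 M
  simp only [expTerm, cf_smul, ← div_eq_inv_mul] at h3
  exact h3

theorem X_mul_omega01 (w : ℕ → PowerSeries (LaurentSeries ℂ)) (s : ℕ+ → ℂ) :
    PowerSeries.X * omega01 w s
      = PowerSeries.mk fun m => if m = 0 then 0 else (onePoint w s m).coeff (-1) := by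
  change euler (H01 w s) = _
  ext m
  rw [coeff_euler, H01, PowerSeries.coeff_mk, PowerSeries.coeff_mk]
  split_ifs with h
  · rw [mul_zero]
  · rw [mul_div_cancel₀ _ (by exact_mod_cast h)]

theorem cf_eq_zero_of_X_one_dvd {f : MvPowerSeries (Fin 2) ℂ}
    (h : (MvPowerSeries.X 1 : MvPowerSeries (Fin 2) ℂ) ∣ f) (n : ℕ) :
    cf f n 0 = 0 := by
  obtain ⟨g, rfl⟩ := h
  simp [cf_mul, cf_X_one]

end LeakyHurwitz

end

/-- The conclusion says, in order: the time-one flow of the Hamiltonian vector field converges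
coefficientwise; the exponentials that define the one-point function converge; `X(z)` is a formal
coordinate at `z = 0`; and the pullback of `ω_{0,1}` along `X = X(z)` is `y dX / X` (multiplied
by `X` and with `dz` left out). -/
theorem mainTheorem6 (w : ℕ → PowerSeries (LaurentSeries ℂ))
    (hw : LeakyHurwitz.TopologicalAssumption w)
    (hs : (MvPowerSeries.X 1 : MvPowerSeries (Fin 2) ℂ) ∣ LeakyHurwitz.dequantisation w)
    (s : ℕ+ → ℂ) :
    (∀ (f : MvPowerSeries (Fin 2) ℂ) (e : Fin 2 →₀ ℕ),
      Summable fun n : ℕ => (1 : ℂ) ^ n / (n ! : ℂ) * MvPowerSeries.coeff e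
        ((LeakyHurwitz.hamiltonianField (LeakyHurwitz.dequantisation w))^[n] f)) ∧
    LeakyHurwitz.HasExp (LeakyHurwitz.ramification s) LeakyHurwitz.vacuum
      (LeakyHurwitz.ramificationVector s) ∧
    LeakyHurwitz.HasExp (LeakyHurwitz.W w) (LeakyHurwitz.ramificationVector s)
      (LeakyHurwitz.expApply (LeakyHurwitz.W w) (LeakyHurwitz.ramificationVector s)) ∧
    PowerSeries.constantCoeff (LeakyHurwitz.curveX w s) = 0 ∧
    PowerSeries.coeff 1 (LeakyHurwitz.curveX w s) ≠ 0 ∧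
    PowerSeries.subst (LeakyHurwitz.curveX w s) (LeakyHurwitz.omega01 w s)
        * PowerSeries.derivative ℂ (LeakyHurwitz.curveX w s) * LeakyHurwitz.curveX w s
      = LeakyHurwitz.curveY w s * PowerSeries.derivative ℂ (LeakyHurwitz.curveX w s) := by
  have hh : ∀ n, LeakyHurwitz.cf (LeakyHurwitz.dequantisation w) n 0 = 0 :=
    LeakyHurwitz.cf_eq_zero_of_X_one_dvd hs
  have hA : PowerSeries.constantCoeff (LeakyHurwitz.ramificationSeries s) = 0 := by
    rw [← PowerSeries.coeff_zero_eq_constantCoeff_apply,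
      LeakyHurwitz.coeff_zero_ramificationSeries]
  have hX := LeakyHurwitz.evalCurve_Xi hh hA
  have hU := LeakyHurwitz.evalCurve_twistedFlow_mul hh hA
  have hc : PowerSeries.constantCoeff (LeakyHurwitz.curveX w s) = 0 := by
    rw [LeakyHurwitz.curveX, hX]; simp
  refine ⟨fun f e => ?_, LeakyHurwitz.hasExp_ramification s, LeakyHurwitz.hasExp_W hh _, hc, ?_, ?_⟩
  · have h1 : ⇑(LeakyHurwitz.twistedField (LeakyHurwitz.dequantisation w) 0)
        = LeakyHurwitz.hamiltonianField (LeakyHurwitz.dequantisation w) :=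
      funext (LeakyHurwitz.twistedField_zero_apply _)
    have h2 := LeakyHurwitz.summable_twistedField hh 0 f (e 0) (e 1)
    rw [h1] at h2
    simpa only [one_pow, one_div, ← div_eq_inv_mul, LeakyHurwitz.coeff_eq_cf] using h2
  · rw [LeakyHurwitz.curveX, hX, ← zero_add 1, PowerSeries.coeff_succ_X_mul,
      PowerSeries.coeff_zero_eq_constantCoeff_apply]
    intro h0
    have h1 := congrArg PowerSeries.constantCoeff hU
    rw [map_mul, h0, zero_mul, map_one] at h1
    exact zero_ne_one h1
  · have h1 := LeakyHurwitz.subst_evalCurve_Xi hh hA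
      (F := PowerSeries.X * LeakyHurwitz.omega01 w s) (fun m => by
        rw [LeakyHurwitz.X_mul_omega01, PowerSeries.coeff_mk]
        split_ifs with hm
        · simp [hm]
        · exact LeakyHurwitz.coeff_onePoint hh s hm)
    have hs' := PowerSeries.HasSubst.of_constantCoeff_zero' hc
    rw [LeakyHurwitz.curveX] at hs' ⊢
    rw [PowerSeries.subst_mul hs', PowerSeries.subst_X hs'] at h1
    rw [LeakyHurwitz.curveY, LeakyHurwitz.evalCurve_Upsilon_zero hh, sub_zero, ← h1]
    ring
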